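/- **Definitions.** Alphabets are finite non-empty sets, and $\Sigma_{\triangleright\triangleleft}=\Sigma\cup\{\triangleright,\triangleleft\}$ is $\Sigma$ with two fresh end markers. A *two-way transducer* from $\Sigma$ to $\Gamma$ is a tuple $\mathcal T=(Q,\rho,q_0,F,\delta)$ with $Q$ a finite set of states, a direction map $\rho:Q\to\{-1,1\}$ (states with $\rho=1$ are forward, the others backward), a forward initial state $q_0$, a set $F\subseteq Q$ of final states, and transitions $\delta:\Sigma_{\triangleright\triangleleft}\to\mathcal P(Q\times\Gamma^*\times Q)$. For $(q,w,r)\in\delta(a)$ and words $u,v$ over $\Sigma_{\triangleright\triangleleft}$ there are steps with output $w$ $$(u,q,av)\to(ua,r,v)\ (\rho(q)=\rho(r)=1),\qquad (u,q,av)\to(u,r,av)\ (\rho(q)=1,\ \rho(r)=-1),$$ $$(ua,q,v)\to(u,r,av)\ (\rho(q)=\rho(r)=-1),\qquad (ua,q,v)\to(ua,r,v)\ (\rho(q)=-1,\ \rho(r)=1).$$ $\mathcal T$ *realizes* $(u,v)$ if some sequence of steps leads from $(\varepsilon,q_0,\triangleright u\triangleleft)$ to $(\triangleright u\triangleleft,q_f,\varepsilon)$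 with $q_f\in F$ and has concatenated output $v$. It is *reversible* (a 2RFT) if for every $a\in\Sigma_{\triangleright\triangleleft}$ the set $\delta(a)$ is a partial function $q\mapsto(w,r)$ and the induced partial function $q\mapsto r$ is injective; it then computes a partial function $\Sigma^*\rightharpoonup\Gamma^*$. A total order $<$ on $Q$ is extended to $Q\times\{-1,1\}$ by putting first all $(q,-1)$, in decreasing order of $q$, and then all $(q,1)$, in increasing order of $q$. The set $\delta(a)$ is *planar* for $<$ if there are no vertices $u<r<v<s$ in $Q\times\{-1,1\}$ such that both $u,v$ and $r,s$ are joined, in some direction, by edges of the graph with edges $(q,-\rho(q))\to(r,\rho(r))$ for $(q,w,r)\in\delta(a)$. The transducer $\mathcal T$ is *planar* if there is a total order on $Q$ for which $\delta(a)$ is planar for every letter $a\in\Sigma$. **Lemma.** Let $\mathcal T_1=(Q,\rho_1,q_0,F_1,\delta_1):\Sigma^*\rightharpoonup\Gamma^*$ and $\mathcal T_2=(R,\rho_2,r_0,F_2,\delta_2):\Gamma^*\rightharpoonup\Delta^*$ be planar 2RFTs. Then some planar 2RFT computes the composition of partial functions $\mathcal T_2\circ\mathcal T_1$. One such transducer is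 the product $\mathcal T=(Q\times R,\ (q,r)\mapsto\rho_1(q)\rho_2(r),\ (q_0,r_0),\ F_1\times F_2,\ \delta)$, where $\delta(a)$ consists of the following transitions, for all $(q,v,q')\in\delta_1'(a)$ and $r,r'\in R$: * $((q,r),w,(q',r'))$ if $\rho_2(r)=\rho_2(r')=1$ and $\mathcal T_2$ goes from $(\varepsilon,r,v)$ to $(v,r',\varepsilon)$ with output $w$; * $((q',r),w,(q,r'))$ if $\rho_2(r)=\rho_2(r')=-1$ and $\mathcal T_2$ goes from $(v,r,\varepsilon)$ to $(\varepsilon,r',v)$ with output $w$; * $((q,r),w,(q,r'))$ if $\rho_2(r)=1=-\rho_2(r')$ and $\mathcal T_2$ goes from $(\varepsilon,r,v)$ to $(\varepsilon,r',v)$ with output $w$; * $((q',r),w,(q',r'))$ if $\rho_2(r)=-1=-\rho_2(r')$ and $\mathcal T_2$ goes from $(v,r,\varepsilon)$ to $(v,r',\varepsilon)$ with output $w$. Here $\delta_1'$ is $\delta_1$ with $\triangleright$ prepended to the output of the transitions on $\triangleright$ that leave $q_0$, and $\triangleleft$ appended to the output of the transitions on $\triangleleft$ that enter a forward state of $F_1$.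 Moreover, for all total orders on $Q$ and $R$, let $Q\times R$ be ordered by $(q,r)<(q',r')$ iff $q<q'$, or $q=q'$ is forward and $r<r'$, or $q=q'$ is backward and $r>r'$. This is a total order. If the transitions of $\mathcal T_1$ and $\mathcal T_2$ on all letters are planar for the given orders, then so are those of $\mathcal T$ on all letters for this order; and the same holds with the end markers included among the letters. -/

import Mathlib

/-- The alphabet `A` extended with the two end markers `▷` and `◁`. -/
inductive TapeSymbol (A : Type*) where
  | letter (a : A) : TapeSymbol A
  | leftEnd : TapeSymbol A
  | rightEnd : TapeSymbol A

/-- The tape `▷ w ◁`. -/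
def tape {A : Type*} (w : List A) : List (TapeSymbol A) :=
  TapeSymbol.leftEnd :: (w.map TapeSymbol.letter ++ [TapeSymbol.rightEnd])

/-- A two-way nondeterministic transducer with input alphabet `A`, output alphabet `B` and finite
set of states `Q`. The direction of a state is `1` (forward) or `-1` (backward). -/
structure TwoWayTransducer (A B Q : Type*) where
  finite_states : Finite Q
  pol : Q → ℤˣ
  init : Q
  init_forward : pol init = 1
  final : Set Q
  δ : TapeSymbol A → Set (Q × List B × Q)

/-- The transition profile of a transition `f ⊆ Q × Q` over the directed set of states
`(Q, pol)`. -/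
def transitionProfile {Q : Type*} (pol : Q → ℤˣ) (f : Set (Q × Q)) : Digraph (Q × ℤˣ) where
  Adj x y := ∃ q r, (q, r) ∈ f ∧ x = (q, -pol q) ∧ y = (r, pol r)

/-- The extension to `Q × {-1, 1}` of a strict total order on `Q`: first the elements `(q, -1)` in
decreasing order of `q`, then the elements `(q, 1)` in increasing order of `q`. -/
def vertexLT {Q : Type*} (lt : Q → Q → Prop) (x y : Q × ℤˣ) : Prop :=
  (x.2 = -1 ∧ y.2 = 1) ∨ (lt x.1 y.1 ∧ x.2 = 1 ∧ y.2 = 1) ∨ (lt y.1 x.1 ∧ x.2 = -1 ∧ y.2 = -1)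

/-- Planarity of a transition with respect to a strict total order on the states and a direction
map. -/
def PlanarTransition {Q : Type*} (lt : Q → Q → Prop) (pol : Q → ℤˣ) (f : Set (Q × Q)) : Prop :=
  ¬ ∃ u r v s : Q × ℤˣ, vertexLT lt u r ∧ vertexLT lt r v ∧ vertexLT lt v s ∧
    ((transitionProfile pol f).Adj u v ∨ (transitionProfile pol f).Adj v u) ∧
    ((transitionProfile pol f).Adj r s ∨ (transitionProfile pol f).Adj s r)

namespace TwoWayTransducer

variable {A B C Q R : Type*}

/-- Immediate successor relation between configurations `(u, q, v)`, labelled by the output. -/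
inductive Step (T : TwoWayTransducer A B Q) :
    List (TapeSymbol A) × Q × List (TapeSymbol A) → List B →
    List (TapeSymbol A) × Q × List (TapeSymbol A) → Prop where
  | forwardForward (u v : List (TapeSymbol A)) (a : TapeSymbol A) (q r : Q) (w : List B) :
      (q, w, r) ∈ T.δ a → T.pol q = 1 → T.pol r = 1 → Step T (u, q, a :: v) w (u ++ [a], r, v)
  | forwardBackward (u v : List (TapeSymbol A)) (a : TapeSymbol A) (q r : Q) (w : List B) :
      (q, w, r) ∈ T.δ a → T.pol q = 1 → T.pol r = -1 → Step T (u, q, a :: v) w (u, r, a :: v)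
  | backwardBackward (u v : List (TapeSymbol A)) (a : TapeSymbol A) (q r : Q) (w : List B) :
      (q, w, r) ∈ T.δ a → T.pol q = -1 → T.pol r = -1 → Step T (u ++ [a], q, v) w (u, r, a :: v)
  | backwardForward (u v : List (TapeSymbol A)) (a : TapeSymbol A) (q r : Q) (w : List B) :
      (q, w, r) ∈ T.δ a → T.pol q = -1 → T.pol r = 1 →
        Step T (u ++ [a], q, v) w (u ++ [a], r, v)

/-- Finite sequences of steps, labelled by the concatenation of the outputs. -/
inductive Run (T : TwoWayTransducer A B Q) :
    List (TapeSymbol A) × Q × List (TapeSymbol A) → List B →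
    List (TapeSymbol A) × Q × List (TapeSymbol A) → Prop where
  | refl (c : List (TapeSymbol A) × Q × List (TapeSymbol A)) : Run T c [] c
  | head (c d e : List (TapeSymbol A) × Q × List (TapeSymbol A)) (w w' : List B) :
      T.Step c w d → Run T d w' e → Run T c (w ++ w') e

/-- `(u, v)` is in the relation realized by `T`. -/
def Realizes (T : TwoWayTransducer A B Q) (u : List A) (v : List B) : Prop :=
  ∃ qf ∈ T.final, T.Run ([], T.init, tape u) v (tape u, qf, [])

/-- On every tape symbol, the transitions form a partial function from states to pairs of an output
word and a state. -/
def IsDeterministic (T : TwoWayTransducer A B Q) : Prop :=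
  ∀ (x : TapeSymbol A) (q r r' : Q) (w w' : List B),
    (q, w, r) ∈ T.δ x → (q, w', r') ∈ T.δ x → w = w' ∧ r = r'

/-- Deterministic, and on every tape symbol the partial function on states is injective. -/
def IsReversible (T : TwoWayTransducer A B Q) : Prop :=
  T.IsDeterministic ∧ ∀ (x : TapeSymbol A) (q q' r : Q) (w w' : List B),
    (q, w, r) ∈ T.δ x → (q', w', r) ∈ T.δ x → q = q'

/-- The transition on states obtained by forgetting the output. -/
def forget (T : TwoWayTransducer A B Q) (x : TapeSymbol A) : Set (Q × Q) :=
  {p | ∃ w, (p.1, w, p.2) ∈ T.δ x}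

/-- The transitions of `T` on all tape symbols of `S` are planar with respect to the given order. -/
def PlanarOn (T : TwoWayTransducer A B Q) (S : Set (TapeSymbol A)) (lt : Q → Q → Prop) : Prop :=
  ∀ x ∈ S, PlanarTransition lt T.pol (T.forget x)

/-- `T` is planar: for some total order on the states, its transitions on all letters of the input
alphabet are planar. -/
def IsPlanar (T : TwoWayTransducer A B Q) : Prop :=
  ∃ lt : Q → Q → Prop, IsStrictTotalOrder Q lt ∧ T.PlanarOn (Set.range TapeSymbol.letter) lt

open Classical in
/-- The transitions of `T`, with outputs modified so that an accepting run outputs `▷ v ◁` where it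
used to output `v`: transitions that leave the initial state on `▷` output an additional `▷` in
front, and transitions that enter a forward final state on `◁` output an additional `◁` at the
end. (In any run from the initial configuration, the former is used at the first step only, and
the latter is used only to accept.) -/
def markedδ (T : TwoWayTransducer A B Q) (x : TapeSymbol A) :
    Set (Q × List (TapeSymbol B) × Q) :=
  {t | ∃ w, (t.1, w, t.2.2) ∈ T.δ x ∧ t.2.1 =
    (if x = TapeSymbol.leftEnd ∧ t.1 = T.init then [TapeSymbol.leftEnd] else []) ++
    w.map TapeSymbol.letter ++
    (if x = TapeSymbol.rightEnd ∧ t.2.2 ∈ T.final ∧ T.pol t.2.2 = 1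
      then [TapeSymbol.rightEnd] else [])}

/-- The transitions of the product of `T₁` and `T₂`. -/
inductive ProductTransition (T₁ : TwoWayTransducer A B Q) (T₂ : TwoWayTransducer B C R)
    (x : TapeSymbol A) : Q × R → List C → Q × R → Prop where
  | leftToRight (q q' : Q) (r r' : R) (v : List (TapeSymbol B)) (w : List C) :
      (q, v, q') ∈ T₁.markedδ x → T₂.pol r = 1 → T₂.pol r' = 1 →
      T₂.Run ([], r, v) w (v, r', []) → ProductTransition T₁ T₂ x (q, r) w (q', r')
  | rightToLeft (q q' : Q) (r r' : R) (v : List (TapeSymbol B)) (w : List C) :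
      (q, v, q') ∈ T₁.markedδ x → T₂.pol r = -1 → T₂.pol r' = -1 →
      T₂.Run (v, r, []) w ([], r', v) → ProductTransition T₁ T₂ x (q', r) w (q, r')
  | leftToLeft (q q' : Q) (r r' : R) (v : List (TapeSymbol B)) (w : List C) :
      (q, v, q') ∈ T₁.markedδ x → T₂.pol r = 1 → T₂.pol r' = -1 →
      T₂.Run ([], r, v) w ([], r', v) → ProductTransition T₁ T₂ x (q, r) w (q, r')
  | rightToRight (q q' : Q) (r r' : R) (v : List (TapeSymbol B)) (w : List C) :
      (q, v, q') ∈ T₁.markedδ x → T₂.pol r = -1 → T₂.pol r' = 1 →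
      T₂.Run (v, r, []) w (v, r', []) → ProductTransition T₁ T₂ x (q', r) w (q', r')

/-- The product construction: first `T₁`, then `T₂`. -/
def product (T₁ : TwoWayTransducer A B Q) (T₂ : TwoWayTransducer B C R) :
    TwoWayTransducer A C (Q × R) where
  finite_states :=
    haveI := T₁.finite_states
    haveI := T₂.finite_states
    inferInstance
  pol s := T₁.pol s.1 * T₂.pol s.2
  init := (T₁.init, T₂.init)
  init_forward := by simp [T₁.init_forward, T₂.init_forward]
  final := T₁.final ×ˢ T₂.final
  δ x := {t | ProductTransition T₁ T₂ x t.1 t.2.1 t.2.2}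

end TwoWayTransducer

/-- The lexicographic order on `Q × R`, where the order of `R` is reversed inside `{q} × R` when
`q` is a backward state. -/
def directedLex {Q R : Type*} (pol : Q → ℤˣ) (lt₁ : Q → Q → Prop) (lt₂ : R → R → Prop)
    (s t : Q × R) : Prop :=
  lt₁ s.1 t.1 ∨ (s.1 = t.1 ∧ ((pol s.1 = 1 ∧ lt₂ s.2 t.2) ∨ (pol s.1 = -1 ∧ lt₂ t.2 s.2)))

/-!
A transition of the product on a letter `a` is a run of `T₂` that crosses the output word `v` of a
transition `q → q'` of `T₁` on `a`. The four kinds of steps, and the four kinds of product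
transitions, are treated uniformly through `atEnd`: a state at one of the two ends of a factor of
the tape. A step joins an inward-facing configuration at an end of a letter to an outward-facing one
(`step_iff`), and a product transition is the same with `v` in place of the letter, the left end
of `v` belonging to `q` and its right end to `q'` (`productTransition_iff`).

*Reversibility.* Runs between entry and exit configurations of a reversible transducer are
determined by either of their ends (`Run.deterministic`, `Run.codeterministic`).

*Composition.* The end markers are accounted for by `marked`, a variant of `T₁` that writes the tape
`▷ v ◁` of `T₂` (`marked_run_iff`). A run of the product moves back and forth on a single run
of `marked`, and `T₂` moves along the output of that run; moving back is possible without branching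
because `T₁` is reversible (`exists_runs_of_product_run`). Conversely, a run of `T₂` on the tape is
cut at the boundaries between the outputs of the single steps of `T₁` (`product_run_of_runs`).

*Planarity.* First, runs through a word do not cross if the transitions on its letters are planar
(`wordEdge_not_crossing`). Fix a run `P`, and label each configuration outside `P` with the parity
of the number of configurations of `P` at the same position of the tape with a smaller state. On
each letter, the configurations of `P` on the two sides are matched among themselves by edges of the
profile, and an edge outside `P` crosses none of these, so it has an even number of points of `P`
between its ends (`card_below_eq_of_edge`). Hence the label is constant along every run disjoint
from `P`, whereas a crossing at the two ends of the word would force two different labels. Second,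
the edges of the product over distinct edges of `T₁` do not cross because these have
disjoint ends and do not cross in `T₁`, and the edges over the same edge of `T₁` are ordered like
the word edges of `T₂`, up to a rotation (`not_crossing_of_same_edge`).
-/

/-! ### Configurations at the two ends of a word -/

/-- The configuration at the left end (`p.2 = -1`) or at the right end (`p.2 = 1`) of the factor `x`
of the tape `u x v`, in state `p.1`. With `x` a letter, the endpoints of the edges of a transition
profile become the configurations related by a step that uses this letter. -/
def atEnd {α Q : Type*} (u x v : List α) (p : Q × ℤˣ) : List α × Q × List α :=
  if p.2 = -1 then (u, p.1, x ++ v) else (u ++ x, p.1, v)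

section atEnd

variable {α Q : Type*} (u x v : List α)

@[simp] theorem atEnd_left (q : Q) : atEnd u x v (q, -1) = (u, q, x ++ v) := by simp [atEnd]

@[simp] theorem atEnd_right (q : Q) : atEnd u x v (q, 1) = (u ++ x, q, v) := by
  simp [atEnd, show (1 : ℤˣ) ≠ -1 by decide]

theorem atEnd_state (p : Q × ℤˣ) : (atEnd u x v p).2.1 = p.1 := by
  unfold atEnd; split_ifs <;> rfl

theorem atEnd_tape (p : Q × ℤˣ) : (atEnd u x v p).1 ++ (atEnd u x v p).2.2 = u ++ x ++ v := by
  unfold atEnd; split_ifs <;> simp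

end atEnd

namespace TwoWayTransducer

variable {A B C Q R : Type*}

/-! ### Steps and runs -/

theorem step_iff (T : TwoWayTransducer A B Q) {c d : List (TapeSymbol A) × Q × List (TapeSymbol A)}
    {w : List B} :
    T.Step c w d ↔ ∃ u a v q r, (q, w, r) ∈ T.δ a ∧ c = atEnd u [a] v (q, -T.pol q) ∧
      d = atEnd u [a] v (r, T.pol r) := by
  constructor
  · rintro (⟨u, v, a, q, r, w, h, hq, hr⟩ | ⟨u, v, a, q, r, w, h, hq, hr⟩ |
      ⟨u, v, a, q, r, w, h, hq, hr⟩ | ⟨u, v, a, q, r, w, h, hq, hr⟩) <;>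
    exact ⟨u, a, v, q, r, h, by simp [hq], by simp [hr]⟩
  · rintro ⟨u, a, v, q, r, h, rfl, rfl⟩
    rcases Int.units_eq_one_or (T.pol q) with hq | hq <;>
    rcases Int.units_eq_one_or (T.pol r) with hr | hr <;> simp only [hq, hr, neg_neg, atEnd_left,
      atEnd_right, List.singleton_append]
    · exact .forwardForward u v a q r w h hq hr
    · exact .forwardBackward u v a q r w h hq hr
    · exact .backwardForward u v a q r w h hq hr
    · exact .backwardBackward u v a q r w h hq hr

/-- `c` is not in a position to be left by a step. -/
def IsExit (T : TwoWayTransducer A B Q) (c : List (TapeSymbol A) × Q × List (TapeSymbol A)) :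
    Prop :=
  ∀ u a v q, c ≠ atEnd u [a] v (q, -T.pol q)

/-- `c` is not in a position to be entered by a step. -/
def IsEntry (T : TwoWayTransducer A B Q) (c : List (TapeSymbol A) × Q × List (TapeSymbol A)) :
    Prop :=
  ∀ u a v q, c ≠ atEnd u [a] v (q, T.pol q)

theorem atEnd_singleton_injective {α : Type*} {u u' v v' : List α} {a a' : α} {q q' : Q}
    {f : Q → ℤˣ} (h : atEnd u [a] v (q, f q) = atEnd u' [a'] v' (q', f q')) :
    u = u' ∧ a = a' ∧ v = v' ∧ q = q' := by
  have hq : q = q' := by simpa only [atEnd_state] using congrArg (fun c => c.2.1) h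
  subst hq
  rcases Int.units_eq_one_or (f q) with hf | hf <;> rw [hf] at h <;> simp at h <;> grind

theorem isExit_atEnd (T : TwoWayTransducer A B Q) (x : List (TapeSymbol A)) (q : Q) :
    T.IsExit (atEnd [] x [] (q, T.pol q)) := by
  intro u a v q' h
  have hq : q = q' := by simpa only [atEnd_state] using congrArg (fun c => c.2.1) h
  subst hq
  rcases Int.units_eq_one_or (T.pol q) with hf | hf <;> rw [hf] at h <;> simp at h

theorem isEntry_atEnd (T : TwoWayTransducer A B Q) (x : List (TapeSymbol A)) (q : Q) :
    T.IsEntry (atEnd [] x [] (q, -T.pol q)) := by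
  intro u a v q' h
  have hq : q = q' := by simpa only [atEnd_state] using congrArg (fun c => c.2.1) h
  subst hq
  rcases Int.units_eq_one_or (T.pol q) with hf | hf <;> rw [hf] at h <;> simp at h

section Runs

variable {T : TwoWayTransducer A B Q} {c d e c' d' : List (TapeSymbol A) × Q × List (TapeSymbol A)}
  {w w' : List B}

theorem IsExit.not_step (h : T.IsExit c) : ¬ T.Step c w d := by
  rw [step_iff]
  rintro ⟨u, a, v, q, r, -, rfl, -⟩
  exact h u a v q rfl

theorem IsEntry.not_step (h : T.IsEntry d) : ¬ T.Step c w d := by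
  rw [step_iff]
  rintro ⟨u, a, v, q, r, -, -, rfl⟩
  exact h u a v r rfl

theorem Step.deterministic (hT : T.IsDeterministic) (h : T.Step c w d) (h' : T.Step c w' d') :
    w = w' ∧ d = d' := by
  obtain ⟨u, a, v, q, r, hδ, rfl, rfl⟩ := T.step_iff.1 h
  obtain ⟨u', a', v', q', r', hδ', hc, rfl⟩ := T.step_iff.1 h'
  obtain ⟨rfl, rfl, rfl, rfl⟩ := atEnd_singleton_injective (f := fun q => -T.pol q) hc
  obtain ⟨rfl, rfl⟩ := hT _ _ _ _ _ _ hδ hδ'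
  exact ⟨rfl, rfl⟩

theorem Step.codeterministic (hT : T.IsReversible) (h : T.Step c w d) (h' : T.Step c' w' d) :
    w = w' ∧ c = c' := by
  obtain ⟨u, a, v, q, r, hδ, rfl, rfl⟩ := T.step_iff.1 h
  obtain ⟨u', a', v', q', r', hδ', rfl, hc⟩ := T.step_iff.1 h'
  obtain ⟨rfl, rfl, rfl, rfl⟩ := atEnd_singleton_injective (f := T.pol) hc
  obtain rfl := hT.2 _ _ _ _ _ _ hδ hδ'
  exact ⟨(hT.1 _ _ _ _ _ _ hδ hδ').1, rfl⟩

theorem Step.run (h : T.Step c w d) : T.Run c w d := by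
  simpa using Run.head c d d w [] h (.refl d)

theorem Run.trans (h : T.Run c w d) (h' : T.Run d w' e) : T.Run c (w ++ w') e := by
  induction h with
  | refl => simpa using h'
  | head c d e' w₁ w₂ hs _ ih => simpa using Run.head _ _ _ _ _ hs (ih h')

theorem Run.tail (h : T.Run c w d) (h' : T.Step d w' e) : T.Run c (w ++ w') e :=
  h.trans h'.run

theorem Run.tail_induction
    {P : List B → List (TapeSymbol A) × Q × List (TapeSymbol A) → Prop}
    (h : T.Run c w d) (refl : P [] c)
    (tail : ∀ w₁ e w₂ f, T.Run c w₁ e → T.Step e w₂ f → P w₁ e → P (w₁ ++ w₂) f) : P w d := by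
  suffices H : ∀ {a b w₂}, T.Run a w₂ b → ∀ w₁, T.Run c w₁ a → P w₁ a → P (w₁ ++ w₂) b by
    simpa using H h [] (.refl c) refl
  intro a b w₂ h₂
  induction h₂ with
  | refl => intro w₁ _ h; simpa using h
  | head x y z v v' hs _ ih =>
    intro w₁ h₁ hP
    simpa using ih (w₁ ++ v) (h₁.tail hs) (tail _ _ _ _ h₁ hs hP)

theorem Run.eq_or_head (h : T.Run c w d) :
    (w = [] ∧ c = d) ∨ ∃ w₁ e w₂, T.Step c w₁ e ∧ T.Run e w₂ d ∧ w = w₁ ++ w₂ := by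
  cases h with
  | refl => exact .inl ⟨rfl, rfl⟩
  | head c e d w₁ w₂ hs hr => exact .inr ⟨w₁, e, w₂, hs, hr, rfl⟩

theorem Run.eq_or_tail (h : T.Run c w d) :
    (w = [] ∧ c = d) ∨ ∃ w₁ e w₂, T.Run c w₁ e ∧ T.Step e w₂ d ∧ w = w₁ ++ w₂ := by
  refine h.tail_induction (P := fun w d => (w = [] ∧ c = d) ∨
    ∃ w₁ e w₂, T.Run c w₁ e ∧ T.Step e w₂ d ∧ w = w₁ ++ w₂) (.inl ⟨rfl, rfl⟩) ?_
  intro w₁ e w₂ f hr hs _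
  exact .inr ⟨w₁, e, w₂, hr, hs, rfl⟩

theorem Run.tape_eq (h : T.Run c w d) : c.1 ++ c.2.2 = d.1 ++ d.2.2 := by
  induction h with
  | refl => rfl
  | head c d e w w' hs _ ih =>
    obtain ⟨u, a, v, q, r, -, rfl, rfl⟩ := T.step_iff.1 hs
    rw [← ih, atEnd_tape, atEnd_tape]

theorem Run.deterministic (hT : T.IsDeterministic) (h : T.Run c w d) (h' : T.Run c w' d')
    (hd : T.IsExit d) (hd' : T.IsExit d') : w = w' ∧ d = d' := by
  induction h generalizing w' with
  | refl =>
    obtain ⟨rfl, rfl⟩ | ⟨_, _, _, hs, -⟩ := h'.eq_or_head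
    · exact ⟨rfl, rfl⟩
    · exact (hd.not_step hs).elim
  | head c e d w₁ w₂ hs _ ih =>
    obtain ⟨rfl, rfl⟩ | ⟨_, _, _, hs', hr', rfl⟩ := h'.eq_or_head
    · exact (hd'.not_step hs).elim
    · obtain ⟨rfl, rfl⟩ := hs.deterministic hT hs'
      obtain ⟨rfl, rfl⟩ := ih hr' hd
      exact ⟨rfl, rfl⟩

theorem Run.codeterministic (hT : T.IsReversible) (h : T.Run c w d) (h' : T.Run c' w' d)
    (hc : T.IsEntry c) (hc' : T.IsEntry c') : w = w' ∧ c = c' := by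
  suffices H : ∀ w', T.Run c' w' d → w = w' ∧ c = c' from H w' h'
  refine h.tail_induction (P := fun w d => ∀ w', T.Run c' w' d → w = w' ∧ c = c') ?_ ?_
  · intro w' h'
    obtain ⟨rfl, rfl⟩ | ⟨_, _, _, -, hs, -⟩ := h'.eq_or_tail
    · exact ⟨rfl, rfl⟩
    · exact (hc.not_step hs).elim
  · intro w₁ e w₂ f _ hs ih w' h'
    obtain ⟨rfl, rfl⟩ | ⟨_, _, _, hr', hs', rfl⟩ := h'.eq_or_tail
    · exact (hc'.not_step hs).elim
    · obtain ⟨rfl, rfl⟩ := hs.codeterministic hT hs'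
      obtain ⟨rfl, rfl⟩ := ih _ hr'
      exact ⟨rfl, rfl⟩

theorem Step.frame (h : T.Step c w d) (x y : List (TapeSymbol A)) :
    T.Step (x ++ c.1, c.2.1, c.2.2 ++ y) w (x ++ d.1, d.2.1, d.2.2 ++ y) := by
  obtain ⟨u, a, v, q, r, hδ, rfl, rfl⟩ := T.step_iff.1 h
  refine T.step_iff.2 ⟨x ++ u, a, v ++ y, q, r, hδ, ?_, ?_⟩
  · unfold atEnd; split_ifs <;> simp
  · unfold atEnd; split_ifs <;> simp

theorem Run.frame (h : T.Run c w d) (x y : List (TapeSymbol A)) :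
    T.Run (x ++ c.1, c.2.1, c.2.2 ++ y) w (x ++ d.1, d.2.1, d.2.2 ++ y) := by
  induction h with
  | refl => exact .refl _
  | head c d e w w' hs _ ih => exact .head _ _ _ _ _ (hs.frame x y) ih

end Runs

/-! ### The transducer with end markers in its output -/

/-- `T` with its transitions modified to write `▷ v ◁` in an accepting run with output `v`. -/
def marked (T : TwoWayTransducer A B Q) : TwoWayTransducer A (TapeSymbol B) Q where
  finite_states := T.finite_states
  pol := T.pol
  init := T.init
  init_forward := T.init_forward
  final := T.final
  δ := T.markedδ

theorem IsReversible.marked {T : TwoWayTransducer A B Q} (hT : T.IsReversible) :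
    T.marked.IsReversible := by
  constructor
  · rintro x q r r' w w' ⟨v, h, hw⟩ ⟨v', h', hw'⟩
    obtain ⟨rfl, rfl⟩ := hT.1 _ _ _ _ _ _ h h'
    exact ⟨hw.trans hw'.symm, rfl⟩
  · rintro x q q' r w w' ⟨v, h, -⟩ ⟨v', h', -⟩
    exact hT.2 _ _ _ _ _ _ h h'

theorem exists_run_of_run_marked {T : TwoWayTransducer A B Q}
    {c d : List (TapeSymbol A) × Q × List (TapeSymbol A)} {z : List (TapeSymbol B)}
    (h : T.marked.Run c z d) : ∃ w, T.Run c w d := by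
  induction h with
  | refl => exact ⟨_, .refl _⟩
  | head c d e w w' hs _ ih =>
    obtain ⟨w₂, h₂⟩ := ih
    obtain ⟨u, a, v, q, r, ⟨w₁, hδ, -⟩, rfl, rfl⟩ := step_iff _ |>.1 hs
    exact ⟨w₁ ++ w₂, .head _ _ _ _ _ ((step_iff _).2 ⟨u, a, v, q, r, hδ, rfl, rfl⟩) h₂⟩

theorem leftEnd_position {u v : List (TapeSymbol A)} {x : List A}
    (h : u ++ TapeSymbol.leftEnd :: v = tape x) : u = [] := by
  cases u with
  | nil => rfl
  | cons b u =>
    have : TapeSymbol.leftEnd ∈ x.map TapeSymbol.letter ++ [TapeSymbol.rightEnd] := by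
      have := (List.cons.inj h).2
      rw [← this]; simp
    simp at this

theorem rightEnd_position {u v : List (TapeSymbol A)} {x : List A} {a : TapeSymbol A}
    (h : u ++ a :: v = tape x) : a = TapeSymbol.rightEnd ↔ v = [] := by
  rcases List.eq_nil_or_concat v with rfl | ⟨v, b, rfl⟩
  · have : (u ++ [a]) = (TapeSymbol.leftEnd :: x.map TapeSymbol.letter) ++ [TapeSymbol.rightEnd] := by
      simpa [tape] using h
    simpa using (List.append_inj' this rfl).2
  · have : (u ++ a :: v) ++ [b] =
        (TapeSymbol.leftEnd :: x.map TapeSymbol.letter) ++ [TapeSymbol.rightEnd] := by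
      simpa [tape] using h
    have h₂ := (List.append_inj' this rfl).1
    have : a ∈ u ++ a :: v := by simp
    rw [h₂] at this
    constructor
    · rintro rfl; simp at this
    · simp

section Realizes

variable (T : TwoWayTransducer A B Q)

theorem isEntry_init (x : List (TapeSymbol A)) : T.IsEntry ([], T.init, x) := by
  simpa [T.init_forward] using T.isEntry_atEnd x T.init

/-- A run that enters a configuration with nothing on the right enters it in a forward state. -/
theorem forward_of_run_to_rightmost {x y : List (TapeSymbol A)} {q r : Q} {w : List B}
    (hx : x ≠ []) (h : T.Run ([], q, x) w (y, r, [])) : T.pol r = 1 := by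
  obtain ⟨-, h⟩ | ⟨_, _, _, -, hs, -⟩ := h.eq_or_tail
  · simp_all
  · obtain ⟨u, a, v, q, r', -, -, h⟩ := T.step_iff.1 hs
    obtain rfl : r = r' := by simpa only [atEnd_state] using congrArg (fun c => c.2.1) h
    rcases Int.units_eq_one_or (T.pol r) with hr | hr
    · exact hr
    · simp [hr] at h

open Classical in
/-- The invariant behind the markers: along a run from the initial configuration, `▷` has been
written as soon as the run has left that configuration, and `◁` exactly when the run has just
accepted. -/
theorem run_marked_of_run {x : List A} {w : List B}
    {d : List (TapeSymbol A) × Q × List (TapeSymbol A)} (h : T.Run ([], T.init, tape x) w d) :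
    T.marked.Run ([], T.init, tape x)
      ((if d = ([], T.init, tape x) then [] else [TapeSymbol.leftEnd]) ++
        w.map TapeSymbol.letter ++
        (if d.2.2 = [] ∧ d.2.1 ∈ T.final ∧ T.pol d.2.1 = 1 then [TapeSymbol.rightEnd] else []))
      d := by
  refine h.tail_induction (P := fun w d => T.marked.Run ([], T.init, tape x)
      ((if d = ([], T.init, tape x) then [] else [TapeSymbol.leftEnd]) ++
        w.map TapeSymbol.letter ++
        (if d.2.2 = [] ∧ d.2.1 ∈ T.final ∧ T.pol d.2.1 = 1 then [TapeSymbol.rightEnd] else []))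
      d) ?_ ?_
  · simpa [tape] using Run.refl _
  · intro w₁ e w₂ f hr hs ih
    have htape := hr.tape_eq
    obtain ⟨u, a, v, q, r, hδ, rfl, rfl⟩ := T.step_iff.1 hs
    simp only [List.nil_append, atEnd_tape, List.append_assoc, List.singleton_append] at htape
    have hf : atEnd u [a] v (r, T.pol r) ≠ ([], T.init, tape x) :=
      fun h => T.isEntry_init (tape x) _ _ _ _ h.symm
    have he : ¬ ((atEnd u [a] v (q, -T.pol q)).2.2 = [] ∧
        (atEnd u [a] v (q, -T.pol q)).2.1 ∈ T.final ∧
        T.pol (atEnd u [a] v (q, -T.pol q)).2.1 = 1) := by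
      rintro ⟨h1, -, h3⟩
      rw [atEnd_state] at h3
      simp only at h3
      simp [h3] at h1
    -- the marker `▷` is written by the step that leaves the initial configuration
    have hleft : (a = TapeSymbol.leftEnd ∧ q = T.init) ↔
        atEnd u [a] v (q, -T.pol q) = ([], T.init, tape x) := by
      constructor
      · rintro ⟨rfl, rfl⟩
        obtain rfl := leftEnd_position htape.symm
        simp [T.init_forward, htape]
      · intro h
        have hq : q = T.init := by simpa only [atEnd_state] using congrArg (fun c => c.2.1) h
        subst hq
        simp only [T.init_forward, atEnd_left, Prod.mk.injEq, true_and] at h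
        have := h.2
        simp [tape] at this
        exact ⟨this.1, rfl⟩
    -- the marker `◁` is written by the step that reads the last symbol of the tape
    have hright : (a = TapeSymbol.rightEnd ∧ r ∈ T.final ∧ T.pol r = 1) ↔
        ((atEnd u [a] v (r, T.pol r)).2.2 = [] ∧
          (atEnd u [a] v (r, T.pol r)).2.1 ∈ T.final ∧
          T.pol (atEnd u [a] v (r, T.pol r)).2.1 = 1) := by
      rw [atEnd_state]
      simp only
      rw [rightEnd_position htape.symm]
      constructor
      · rintro ⟨rfl, h2, h3⟩
        exact ⟨by simp [h3], h2, h3⟩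
      · rintro ⟨h1, h2, h3⟩
        exact ⟨by simpa [h3] using h1, h2, h3⟩
    have hstep : T.marked.Step (atEnd u [a] v (q, -T.pol q))
        ((if a = TapeSymbol.leftEnd ∧ q = T.init then [TapeSymbol.leftEnd] else []) ++
          w₂.map TapeSymbol.letter ++
          (if a = TapeSymbol.rightEnd ∧ r ∈ T.final ∧ T.pol r = 1
            then [TapeSymbol.rightEnd] else [])) (atEnd u [a] v (r, T.pol r)) :=
      T.marked.step_iff.2 ⟨u, a, v, q, r, ⟨w₂, hδ, rfl⟩, rfl, rfl⟩
    have := ih.tail hstep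
    rw [if_neg he] at this
    rw [if_neg hf]
    simp only [hright] at this
    convert this using 1
    by_cases hi : atEnd u [a] v (q, -T.pol q) = ([], T.init, tape x)
    · -- the run has returned to its start, hence is empty
      have hw : w₁ = [] := by
        rw [hi] at hr
        obtain ⟨h, -⟩ | ⟨_, _, _, -, hs, -⟩ := hr.eq_or_tail
        · exact h
        · exact ((T.isEntry_init _).not_step hs).elim
      rw [if_pos hi, if_pos (hleft.2 hi), hw]; simp
    · rw [if_neg hi, if_neg (mt hleft.1 hi)]; simp

/-- `T` realizes `(x, v)` iff the marked transducer has an accepting run on `x` with output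
`▷ v ◁`, and every output of such a run has this form. -/
theorem marked_run_iff (hT : T.IsReversible) {x : List A} {z : List (TapeSymbol B)} {q : Q}
    (hq : q ∈ T.final) :
    T.marked.Run ([], T.init, tape x) z (tape x, q, []) ↔
      ∃ v, z = tape v ∧ T.Run ([], T.init, tape x) v (tape x, q, []) := by
  have key : ∀ v, T.Run ([], T.init, tape x) v (tape x, q, []) →
      T.marked.Run ([], T.init, tape x) (tape v) (tape x, q, []) := by
    intro v h
    have hp := T.forward_of_run_to_rightmost (by simp [tape]) h
    have := T.run_marked_of_run h
    rw [if_neg (by simp [tape]), if_pos ⟨rfl, hq, hp⟩] at this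
    simpa [tape] using this
  constructor
  · intro h
    obtain ⟨v, hv⟩ := exists_run_of_run_marked h
    have hp := T.forward_of_run_to_rightmost (by simp [tape]) hv
    have hx : T.marked.IsExit (tape x, q, []) := by
      simpa [show T.marked.pol q = 1 from hp] using T.marked.isExit_atEnd (tape x) q
    exact ⟨v, (h.deterministic hT.marked.1 (key v hv) hx hx).1, hv⟩
  · rintro ⟨v, rfl, h⟩
    exact key v h

end Realizes

/-! ### The product construction -/

section Product

variable {T₁ : TwoWayTransducer A B Q} {T₂ : TwoWayTransducer B C R}

/-- The four kinds of transitions of the product, as one: a run of `T₂` through the output `v` of a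
transition `(q, v, q')` of `T₁`, where the left end of `v` belongs to `q` and its right end to
`q'`. -/
theorem productTransition_iff {x : TapeSymbol A} {s s' : Q × R} {w : List C} :
    ProductTransition T₁ T₂ x s w s' ↔ ∃ q v q' r r', (q, v, q') ∈ T₁.markedδ x ∧
      T₂.Run (atEnd [] v [] (r, -T₂.pol r)) w (atEnd [] v [] (r', T₂.pol r')) ∧
      s = (if -T₂.pol r = -1 then q else q', r) ∧ s' = (if T₂.pol r' = -1 then q else q', r') := by
  constructor
  · rintro (⟨q, q', r, r', v, w, hδ, hr, hr', h⟩ | ⟨q, q', r, r', v, w, hδ, hr, hr', h⟩ |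
      ⟨q, q', r, r', v, w, hδ, hr, hr', h⟩ | ⟨q, q', r, r', v, w, hδ, hr, hr', h⟩) <;>
    exact ⟨q, v, q', r, r', hδ, by simpa [hr, hr'] using h, by simp [hr, units_ne_neg_self],
      by simp [hr', units_ne_neg_self]⟩
  · rintro ⟨q, v, q', r, r', hδ, h, rfl, rfl⟩
    rcases Int.units_eq_one_or (T₂.pol r) with hr | hr <;>
    rcases Int.units_eq_one_or (T₂.pol r') with hr' | hr' <;>
    simp only [hr, hr', neg_neg, atEnd_left, atEnd_right, List.nil_append, List.append_nil] at h <;>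
    simp only [hr, hr', neg_neg, if_true, show (1 : ℤˣ) ≠ -1 by decide, if_false]
    · exact .leftToRight _ _ _ _ _ _ hδ hr hr' h
    · exact .leftToLeft _ _ _ _ _ _ hδ hr hr' h
    · exact .rightToRight _ _ _ _ _ _ hδ hr hr' h
    · exact .rightToLeft _ _ _ _ _ _ hδ hr hr' h

/-- In a reversible transducer, a transition is determined by either of its two states. -/
theorem IsReversible.eq_of_end {T : TwoWayTransducer A B Q} (hT : T.IsReversible) {x : TapeSymbol A}
    {q₁ q₁' q₂ q₂' : Q} {v₁ v₂ : List B} (h₁ : (q₁, v₁, q₁') ∈ T.δ x) (h₂ : (q₂, v₂, q₂') ∈ T.δ x)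
    (σ : ℤˣ) (h : (if σ = -1 then q₁ else q₁') = if σ = -1 then q₂ else q₂') :
    q₁ = q₂ ∧ v₁ = v₂ ∧ q₁' = q₂' := by
  split_ifs at h
  · subst h
    exact ⟨rfl, hT.1 _ _ _ _ _ _ h₁ h₂⟩
  · subst h
    obtain rfl := hT.2 _ _ _ _ _ _ h₁ h₂
    exact ⟨rfl, hT.1 _ _ _ _ _ _ h₁ h₂⟩

theorem product_isReversible (h₁ : T₁.IsReversible) (h₂ : T₂.IsReversible) :
    (T₁.product T₂).IsReversible := by
  constructor
  · intro x s t t' w w' h h'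
    obtain ⟨q, v, q', r, r', hδ, hr, rfl, rfl⟩ := productTransition_iff.1 h
    obtain ⟨p, v', p', k, k', hδ', hr', hs, rfl⟩ := productTransition_iff.1 h'
    obtain ⟨hq, rfl⟩ := Prod.mk.inj hs
    obtain ⟨rfl, rfl, rfl⟩ := h₁.marked.eq_of_end hδ hδ' _ hq
    obtain ⟨rfl, h⟩ := hr.deterministic h₂.1 hr' (T₂.isExit_atEnd _ _) (T₂.isExit_atEnd _ _)
    obtain rfl : r' = k' := by simpa only [atEnd_state] using congrArg (fun c => c.2.1) h
    exact ⟨rfl, rfl⟩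
  · intro x s s' t w w' h h'
    obtain ⟨q, v, q', r, r', hδ, hr, rfl, rfl⟩ := productTransition_iff.1 h
    obtain ⟨p, v', p', k, k', hδ', hr', rfl, hs⟩ := productTransition_iff.1 h'
    obtain ⟨hq, rfl⟩ := Prod.mk.inj hs
    obtain ⟨rfl, rfl, rfl⟩ := h₁.marked.eq_of_end hδ hδ' _ hq
    obtain ⟨-, h⟩ := hr.codeterministic h₂ hr' (T₂.isEntry_atEnd _ _) (T₂.isEntry_atEnd _ _)
    obtain rfl : r = k := by simpa only [atEnd_state] using congrArg (fun c => c.2.1) h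
    rfl

/-- The configuration `c` of `T₁`, with the state paired with the state `r` of `T₂`. -/
def pairConfig {α : Type*} (c : List α × Q × List α) (r : R) : List α × (Q × R) × List α :=
  (c.1, (c.2.1, r), c.2.2)

/-- A step of the product is a step `e → e'` of `T₁` with marked output `y`, together with a run of
`T₂` through `y`; the product is in `e` when `T₂` is at the left end of `y`, and in `e'` when
`T₂` is at its right end. -/
theorem product_step_iff {s t : List (TapeSymbol A) × (Q × R) × List (TapeSymbol A)} {w : List C} :
    (T₁.product T₂).Step s w t ↔ ∃ e y e' r r', T₁.marked.Step e y e' ∧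
      T₂.Run (atEnd [] y [] (r, -T₂.pol r)) w (atEnd [] y [] (r', T₂.pol r')) ∧
      s = pairConfig (if -T₂.pol r = -1 then e else e') r ∧
      t = pairConfig (if T₂.pol r' = -1 then e else e') r' := by
  have key : ∀ (u v : List (TapeSymbol A)) (a : TapeSymbol A) (q q' : Q) (r r' : R),
      atEnd u [a] v ((if -T₂.pol r = -1 then q else q', r),
        -(T₁.pol (if -T₂.pol r = -1 then q else q') * T₂.pol r)) =
      pairConfig (if -T₂.pol r = -1 then atEnd u [a] v (q, -T₁.pol q)
        else atEnd u [a] v (q', T₁.pol q')) r ∧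
      atEnd u [a] v ((if T₂.pol r' = -1 then q else q', r'),
        (T₁.pol (if T₂.pol r' = -1 then q else q') * T₂.pol r')) =
      pairConfig (if T₂.pol r' = -1 then atEnd u [a] v (q, -T₁.pol q)
        else atEnd u [a] v (q', T₁.pol q')) r' := by
    intro u v a q q' r r'
    constructor
    · rcases Int.units_eq_one_or (T₂.pol r) with hr | hr <;>
      rcases Int.units_eq_one_or (T₁.pol q) with hq | hq <;>
      rcases Int.units_eq_one_or (T₁.pol q') with hq' | hq' <;>
      simp [pairConfig, hr, hq, hq', show (1 : ℤˣ) ≠ -1 by decide]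
    · rcases Int.units_eq_one_or (T₂.pol r') with hr | hr <;>
      rcases Int.units_eq_one_or (T₁.pol q) with hq | hq <;>
      rcases Int.units_eq_one_or (T₁.pol q') with hq' | hq' <;>
      simp [pairConfig, hr, hq, hq', show (1 : ℤˣ) ≠ -1 by decide]
  constructor
  · intro h
    obtain ⟨u, a, v, s, s', hδ, rfl, rfl⟩ := (step_iff _).1 h
    obtain ⟨q, y, q', r, r', hδ', hr, rfl, rfl⟩ := productTransition_iff.1 hδ
    exact ⟨_, y, _, r, r', T₁.marked.step_iff.2 ⟨u, a, v, q, q', hδ', rfl, rfl⟩, hr,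
      (key u v a q q' r r').1, (key u v a q q' r r').2⟩
  · rintro ⟨e, y, e', r, r', hs, hr, rfl, rfl⟩
    obtain ⟨u, a, v, q, q', hδ, rfl, rfl⟩ := T₁.marked.step_iff.1 hs
    exact (step_iff _).2 ⟨u, a, v, _, _, productTransition_iff.2 ⟨q, y, q', r, r', hδ, hr, rfl, rfl⟩,
      (key u v a q q' r r').1.symm, (key u v a q q' r r').2.symm⟩

end Product

end TwoWayTransducer

/-! ### Orders on states and vertices -/

section Orders

variable {Q R : Type*}

theorem isStrictTotalOrder_vertexLT (lt : Q → Q → Prop) [IsStrictTotalOrder Q lt] :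
    IsStrictTotalOrder (Q × ℤˣ) (vertexLT lt) where
  irrefl := by
    rintro ⟨q, σ⟩ h
    have := irrefl_of lt q
    rcases Int.units_eq_one_or σ with rfl | rfl <;>
      simp [vertexLT, this, show (1 : ℤˣ) ≠ -1 by decide] at h
  trans := by
    rintro ⟨q, σ⟩ ⟨r, τ⟩ ⟨s, ν⟩ h h'
    have h₁ : lt q r → lt r s → lt q s := trans_of lt
    have h₂ : lt s r → lt r q → lt s q := trans_of lt
    rcases Int.units_eq_one_or σ with rfl | rfl <;> rcases Int.units_eq_one_or τ with rfl | rfl <;>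
      rcases Int.units_eq_one_or ν with rfl | rfl <;>
      simp [vertexLT, show (1 : ℤˣ) ≠ -1 by decide, show (-1 : ℤˣ) ≠ 1 by decide] at h h' ⊢ <;>
      tauto
  trichotomous := by
    rintro ⟨q, σ⟩ ⟨r, τ⟩ h h'
    have h₁ : ¬ lt q r → ¬ lt r q → q = r := Std.Trichotomous.trichotomous q r
    rcases Int.units_eq_one_or σ with rfl | rfl <;> rcases Int.units_eq_one_or τ with rfl | rfl <;>
      simp [vertexLT, show (1 : ℤˣ) ≠ -1 by decide, show (-1 : ℤˣ) ≠ 1 by decide] at h h' ⊢ <;>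
      tauto

theorem isStrictTotalOrder_directedLex (pol : Q → ℤˣ) (lt₁ : Q → Q → Prop) (lt₂ : R → R → Prop)
    [IsStrictTotalOrder Q lt₁] [IsStrictTotalOrder R lt₂] :
    IsStrictTotalOrder (Q × R) (directedLex pol lt₁ lt₂) where
  irrefl := by
    rintro ⟨q, r⟩ h
    simp [directedLex, irrefl_of lt₁ q, irrefl_of lt₂ r] at h
  trans := by
    rintro ⟨q, r⟩ ⟨q', r'⟩ ⟨q'', r''⟩ h h'
    simp only [directedLex] at h h' ⊢
    rcases h with h | ⟨rfl, h⟩ <;> rcases h' with h' | ⟨rfl, h'⟩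
    · exact .inl (trans_of lt₁ h h')
    · exact .inl h
    · exact .inl h'
    · have h₁ : lt₂ r r' → lt₂ r' r'' → lt₂ r r'' := trans_of lt₂
      have h₂ : lt₂ r'' r' → lt₂ r' r → lt₂ r'' r := trans_of lt₂
      rcases Int.units_eq_one_or (pol q) with hq | hq <;>
      simp [hq, show (1 : ℤˣ) ≠ -1 by decide, show (-1 : ℤˣ) ≠ 1 by decide] at h h' ⊢ <;>
      tauto
  trichotomous := by
    rintro ⟨q, r⟩ ⟨q', r'⟩ h h'
    have h₁ : ¬ lt₁ q q' → ¬ lt₁ q' q → q = q' := Std.Trichotomous.trichotomous q q'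
    have h₂ : ¬ lt₂ r r' → ¬ lt₂ r' r → r = r' := Std.Trichotomous.trichotomous r r'
    simp only [directedLex] at h h'
    push Not at h h'
    obtain rfl := h₁ h.1 h'.1
    rcases Int.units_eq_one_or (pol q) with hq | hq
    · obtain rfl := h₂ ((h.2 rfl).1 hq) ((h'.2 rfl).1 hq); rfl
    · obtain rfl := h₂ ((h'.2 rfl).2 hq) ((h.2 rfl).2 hq); rfl

end Orders

/-! ### Parity and non-crossing edges -/

open Classical in
/-- If a set `S` of points is matched within itself by edges of a non-crossing partial matching,
then any other edge `{x, y}` has an even number of points of `S` between its endpoints: an edge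
within `S` has both or none of its endpoints there. -/
theorem card_below_eq_of_edge {α : Type*} {lt : α → α → Prop} (hlt : IsStrictTotalOrder α lt)
    {E : α → α → Prop} (hsymm : ∀ {a b}, E a b → E b a) (hirr : ∀ a, ¬ E a a)
    (huniq : ∀ {a b c}, E a b → E a c → b = c)
    (hplanar : ∀ {u r v s}, lt u r → lt r v → lt v s → E u v → E r s → False)
    {S : Finset α} (hS : ∀ p ∈ S, ∃ p' ∈ S, E p p') {x y : α} (hx : x ∉ S) (hxy : E x y) :
    ((S.filter (lt · x)).card : ZMod 2) = (S.filter (lt · y)).card := by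
  have hy : y ∉ S := by
    intro hy
    obtain ⟨p, hp, hyp⟩ := hS y hy
    exact hx (huniq hyp (hsymm hxy) ▸ hp)
  rw [← sub_eq_zero, CharTwo.sub_eq_add]
  simp only [Finset.card_filter, Nat.cast_sum, Nat.cast_ite, Nat.cast_one, Nat.cast_zero,
    ← Finset.sum_add_distrib]
  choose! μ hμS hμ using hS
  refine Finset.sum_involution (fun p _ => μ p) ?_ ?_ (fun p hp => hμS p hp) ?_
  · intro p hp
    let := linearOrderOfSTO lt
    have hlt' : ∀ a b, lt a b ↔ a < b := fun _ _ => Iff.rfl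
    simp only [hlt'] at hplanar ⊢
    have hm := hμS p hp
    have hE := hμ p hp
    generalize μ p = m at hm hE
    have hpx : p ≠ x := by rintro rfl; exact hx hp
    have hpy : p ≠ y := by rintro rfl; exact hy hp
    have hmx : m ≠ x := by rintro rfl; exact hx hm
    have hmy : m ≠ y := by rintro rfl; exact hy hm
    have hE' := hsymm hE
    have hyx := hsymm hxy
    rcases lt_or_gt_of_ne hpx with h1 | h1 <;> rcases lt_or_gt_of_ne hpy with h2 | h2 <;>
    rcases lt_or_gt_of_ne hmx with h3 | h3 <;> rcases lt_or_gt_of_ne hmy with h4 | h4 <;>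
    simp only [h1, h2, h3, h4, h1.not_gt, h2.not_gt, h3.not_gt, h4.not_gt, if_true, if_false] <;>
    grind
  · intro p hp _ h
    exact hirr p (by simpa [h] using hμ p hp)
  · intro p hp
    exact huniq (hμ _ (hμS p hp)) (hsymm (hμ p hp))

open Classical in
/-- For a point `x` outside `S`, the points of `S` below `x` are, modulo 2, all those on the left
side (`-1`) and those on the side of `x` with a smaller state. Thus the latter count, which does not
refer to the other side, measures the parity of the former up to a constant. -/
theorem card_below_eq_add {R : Type*} {lt : R → R → Prop} [IsStrictTotalOrder R lt]
    {S : Finset (R × ℤˣ)} {x : R × ℤˣ} (hx : x ∉ S) :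
    ((S.filter (vertexLT lt · x)).card : ZMod 2) = (S.filter (·.2 = -1)).card +
      (S.filter (fun p => p.2 = x.2 ∧ lt p.1 x.1)).card := by
  simp only [Finset.card_filter, Nat.cast_sum, Nat.cast_ite, Nat.cast_one, Nat.cast_zero,
    ← Finset.sum_add_distrib]
  refine Finset.sum_congr rfl fun p hp => ?_
  obtain ⟨p, σ⟩ := p
  obtain ⟨x, τ⟩ := x
  rcases Int.units_eq_one_or σ with rfl | rfl <;> rcases Int.units_eq_one_or τ with rfl | rfl <;>
    simp [vertexLT, show (1 : ℤˣ) ≠ -1 by decide, show (-1 : ℤˣ) ≠ 1 by decide]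
  have hne : p ≠ x := by rintro rfl; exact hx hp
  by_cases h : lt p x
  · simp only [h, asymm_of lt h, if_true, if_false]; decide
  · have h' : lt x p := by
      by_contra h'
      exact hne (Std.Trichotomous.trichotomous p x h h')
    simp [h, h']

namespace TwoWayTransducer

variable {A B C Q R : Type*}

/-! ### The product computes the composition -/

section Composition

variable {T₁ : TwoWayTransducer A B Q} {T₂ : TwoWayTransducer B C R}

theorem Run.frame_atEnd {T : TwoWayTransducer A B Q} {x : List (TapeSymbol A)} {p p' : Q × ℤˣ}
    {w : List B} (h : T.Run (atEnd [] x [] p) w (atEnd [] x [] p')) (u v : List (TapeSymbol A)) :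
    T.Run (atEnd u x v p) w (atEnd u x v p') := by
  have := h.frame u v
  have key : ∀ p : Q × ℤˣ, atEnd u x v p =
      (u ++ (atEnd [] x [] p).1, (atEnd [] x [] p).2.1, (atEnd [] x [] p).2.2 ++ v) := by
    intro p
    unfold atEnd; split_ifs <;> simp
  rwa [key, key]

/-- A run of the product from its initial configuration follows a run of `T₁` with marked output
`z ++ y`, being at the moment at the configuration `c` of `T₁` that is reached with output `z`,
while `T₂` runs on the tape `z ++ y` and is at the moment between `z` and `y`. -/
theorem exists_runs_of_product_run (h₁ : T₁.IsReversible) {x : List (TapeSymbol A)} {w : List C}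
    {s : List (TapeSymbol A) × (Q × R) × List (TapeSymbol A)}
    (h : (T₁.product T₂).Run ([], (T₁.init, T₂.init), x) w s) :
    ∃ c r z y c', s = pairConfig c r ∧ T₁.marked.Run ([], T₁.init, x) z c ∧
      T₁.marked.Run c y c' ∧ T₂.Run ([], T₂.init, z ++ y) w (z, r, y) := by
  refine h.tail_induction (P := fun w s => ∃ c r z y c', s = pairConfig c r ∧
      T₁.marked.Run ([], T₁.init, x) z c ∧ T₁.marked.Run c y c' ∧
      T₂.Run ([], T₂.init, z ++ y) w (z, r, y)) ?_ ?_
  · exact ⟨_, _, [], [], _, rfl, .refl _, .refl _, .refl _⟩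
  · rintro w₁ s w₂ t - hst ⟨c, r, z, y, c', rfl, hz, hy, hr⟩
    obtain ⟨e, v, e', r₁, r', hs, hr₁, hc, rfl⟩ := product_step_iff.1 hst
    obtain rfl : r = r₁ := congrArg (fun c => c.2.1.2) hc
    have hc : c = if -T₂.pol r = -1 then e else e' := by
      generalize (if -T₂.pol r = -1 then e else e') = f at hc
      obtain ⟨c1, c2, c3⟩ := c
      obtain ⟨f1, f2, f3⟩ := f
      simp only [pairConfig, Prod.mk.injEq, and_true] at hc ⊢
      exact hc
    subst hc
    -- locate the step `e → e'` in the run of `T₁`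
    obtain ⟨z', y', c'', hz', hy', hr'⟩ : ∃ z' y' c'', T₁.marked.Run ([], T₁.init, x) z' e ∧
        T₁.marked.Run e' y' c'' ∧ T₂.Run ([], T₂.init, z' ++ v ++ y') w₁
          (atEnd z' v y' (r, -T₂.pol r)) := by
      rcases Int.units_eq_one_or (T₂.pol r) with hp | hp
      · simp only [hp, if_true] at hz hy
        simp only [hp, atEnd_left]
        obtain ⟨rfl, rfl⟩ | ⟨v', f, y', hs', hy', rfl⟩ := hy.eq_or_head
        · -- the step lies beyond the part of the run of `T₁` seen by `T₂`: extend the tape of `T₂`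
          exact ⟨z, [], e', hz, .refl _, by simpa using hr.frame [] v⟩
        · obtain ⟨rfl, rfl⟩ := hs.deterministic h₁.marked.1 hs'
          exact ⟨z, y', c', hz, hy', by simpa using hr⟩
      · simp only [hp, neg_neg, show (1 : ℤˣ) ≠ -1 by decide, if_false] at hz hy
        simp only [hp, neg_neg, atEnd_right]
        obtain ⟨rfl, rfl⟩ | ⟨z', f, v', hz', hs', rfl⟩ := hz.eq_or_tail
        · exact ((T₁.marked.isEntry_init x).not_step hs).elim
        · obtain ⟨rfl, rfl⟩ := hs.codeterministic h₁.marked hs'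
          exact ⟨z', y, c', hz', hy, hr⟩
    have hrun := hr'.trans (hr₁.frame_atEnd z' y')
    rcases Int.units_eq_one_or (T₂.pol r') with hp | hp
    · refine ⟨e', r', z' ++ v, y', c'', by simp [hp, show (1 : ℤˣ) ≠ -1 by decide], hz'.tail hs, hy',
        by simpa [hp] using hrun⟩
    · refine ⟨e, r', z', v ++ y', c'', by simp [hp], hz', .head _ _ _ _ _ hs hy',
        by simpa [hp] using hrun⟩

/-- Runs with a given number of steps. -/
inductive RunOfLength (T : TwoWayTransducer A B Q) :
    ℕ → List (TapeSymbol A) × Q × List (TapeSymbol A) → List B →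
    List (TapeSymbol A) × Q × List (TapeSymbol A) → Prop where
  | refl (c : List (TapeSymbol A) × Q × List (TapeSymbol A)) : RunOfLength T 0 c [] c
  | head {n : ℕ} {c d e : List (TapeSymbol A) × Q × List (TapeSymbol A)} {w w' : List B} :
      T.Step c w d → RunOfLength T n d w' e → RunOfLength T (n + 1) c (w ++ w') e

theorem Run.exists_length {T : TwoWayTransducer A B Q}
    {c d : List (TapeSymbol A) × Q × List (TapeSymbol A)} {w : List B} (h : T.Run c w d) :
    ∃ n, T.RunOfLength n c w d := by
  induction h with
  | refl => exact ⟨0, .refl _⟩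
  | head _ _ _ _ _ hs _ ih =>
    obtain ⟨n, ih⟩ := ih
    exact ⟨n + 1, .head hs ih⟩

/-- A run that ends at the right end of the tape and is now inside the factor `a ++ b` first gets to
one of the two ends of this factor in a state that faces outwards. If this takes no step
(`m = n`), the run is at such an end already. -/
theorem RunOfLength.exists_exit {T : TwoWayTransducer A B Q} {n : ℕ}
    {z a b y : List (TapeSymbol A)} {r rf : Q} {w : List B}
    (h : T.RunOfLength n (z ++ a, r, b ++ y) w (z ++ a ++ b ++ y, rf, []))
    (hrf : T.pol rf = 1) :
    ∃ r' w₁ w₂ m, T.Run (a, r, b) w₁ (atEnd [] (a ++ b) [] (r', T.pol r')) ∧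
      T.RunOfLength m (atEnd z (a ++ b) y (r', T.pol r')) w₂ (z ++ a ++ b ++ y, rf, []) ∧
      w = w₁ ++ w₂ ∧ m ≤ n ∧
      (m = n → (a, r, b) = atEnd [] (a ++ b) [] (r', T.pol r')) := by
  generalize hE : z ++ a ++ b ++ y = E at h ⊢
  induction n generalizing a b r w with
  | zero =>
    generalize hc : (z ++ a, r, b ++ y) = c at h
    generalize hd : (E, rf, ([] : List (TapeSymbol A))) = d at h
    cases h with
    | refl =>
      subst hc
      obtain ⟨rfl, rfl, h⟩ : E = z ++ a ∧ rf = r ∧ [] = b ++ y := by simpa using hd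
      obtain ⟨rfl, rfl⟩ : b = [] ∧ y = [] := by simpa using h.symm
      refine ⟨rf, [], [], 0, ?_, ?_, rfl, le_rfl, fun _ => ?_⟩
      · simpa [hrf] using Run.refl _
      · simpa [hrf] using RunOfLength.refl _
      · simp [hrf]
  | succ n ih =>
    by_cases hout : (b = [] ∧ T.pol r = 1) ∨ (a = [] ∧ T.pol r = -1)
    · refine ⟨r, [], w, n + 1, ?_, ?_, rfl, le_rfl, fun _ => ?_⟩
      · rcases hout with ⟨rfl, hr⟩ | ⟨rfl, hr⟩
        · simpa [hr] using Run.refl _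
        · simpa [hr] using Run.refl _
      · rcases hout with ⟨rfl, hr⟩ | ⟨rfl, hr⟩
        · simpa [hr] using h
        · simpa [hr] using h
      · rcases hout with ⟨rfl, hr⟩ | ⟨rfl, hr⟩
        · simp [hr]
        · simp [hr]
    · generalize hc : (z ++ a, r, b ++ y) = c at h
      cases h with
      | @head _ _ d _ w₁ w₂ hs hrun =>
        subst hc
        obtain ⟨a', r', b', hab, rfl, hs'⟩ : ∃ a' r' b', a' ++ b' = a ++ b ∧
            d = (z ++ a', r', b' ++ y) ∧ T.Step (a, r, b) w₁ (a', r', b') := by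
          obtain ⟨u, g, v, q, q', hδ, hc, rfl⟩ := T.step_iff.1 hs
          obtain rfl : r = q := by simpa only [atEnd_state] using congrArg (fun c => c.2.1) hc
          -- the symbol read lies in the factor
          obtain ⟨u', v', rfl, rfl, hc'⟩ : ∃ u' v', u = z ++ u' ∧ v = v' ++ y ∧
              (a, r, b) = atEnd u' [g] v' (r, -T.pol r) := by
            rcases Int.units_eq_one_or (T.pol r) with hr | hr
            · simp only [hr, and_true, show (1 : ℤˣ) ≠ -1 by decide, and_false, or_false] at hout
              obtain ⟨g', b, rfl⟩ := List.exists_cons_of_ne_nil hout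
              simp [hr] at hc
              exact ⟨a, b, hc.1.symm, hc.2.2.symm, by simp [hr, hc.2.1]⟩
            · simp only [hr, and_true, show (-1 : ℤˣ) ≠ 1 by decide, and_false, false_or] at hout
              obtain ⟨a, g', rfl⟩ := (List.eq_nil_or_concat a).resolve_left hout
              simp only [hr, neg_neg, atEnd_right, Prod.mk.injEq, true_and, List.concat_eq_append,
                ← List.append_assoc] at hc
              obtain ⟨h1, h2⟩ := List.append_inj' hc.1 rfl
              exact ⟨a, b, h1.symm, hc.2.symm, by simpa [hr] using h2⟩
          refine ⟨(atEnd u' [g] v' (q', T.pol q')).1, q', (atEnd u' [g] v' (q', T.pol q')).2.2,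
            ?_, ?_, ?_⟩
          · have := atEnd_tape u' [g] v' (r, -T.pol r)
            rw [← hc'] at this
            rw [atEnd_tape, ← this]
          · unfold atEnd; split_ifs <;> simp
          · refine T.step_iff.2 ⟨u', g, v', r, q', hδ, hc', ?_⟩
            unfold atEnd; split_ifs <;> rfl
        obtain ⟨k, v₁, v₂, m, hk, hm, rfl, hmn, -⟩ := ih (a := a') (b := b') (by
          rw [List.append_assoc z, hab, ← List.append_assoc, hE]) hrun
        rw [hab] at hk hm
        exact ⟨k, w₁ ++ v₁, v₂, m, .head _ _ _ _ _ hs' hk, hm, by simp, by omega,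
          fun h => by omega⟩

/-- The product simulates an accepting run of `T₂` on the marked output `z ++ y` of a run of `T₁`.
By induction on the number of remaining steps of `T₂`; while `T₂` does not move because the
outputs of `T₁` are empty, the product follows the run of `T₁` in one direction. -/
theorem product_run_of_runs {n : ℕ} {c₀ cf c : List (TapeSymbol A) × Q × List (TapeSymbol A)}
    {z y : List (TapeSymbol B)} {r rf : R} {w : List C} (hrf : T₂.pol rf = 1)
    (hz : T₁.marked.Run c₀ z c) (hy : T₁.marked.Run c y cf)
    (h : T₂.RunOfLength n (z, r, y) w (z ++ y, rf, [])) :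
    (T₁.product T₂).Run (pairConfig c r) w (pairConfig cf rf) := by
  induction n using Nat.strong_induction_on generalizing c z y r w with
  | _ n ih =>
  -- the product traverses one step `e → e'` of `T₁`
  have cross : ∀ {e e' : List (TapeSymbol A) × Q × List (TapeSymbol A)}
      {z₁ v y₂ : List (TapeSymbol B)} {r : R} {w : List C}, T₁.marked.Run c₀ z₁ e →
      T₁.marked.Step e v e' → T₁.marked.Run e' y₂ cf →
      T₂.RunOfLength n (atEnd z₁ v y₂ (r, -T₂.pol r)) w (z₁ ++ v ++ y₂, rf, []) →
      (v = [] → T₂.RunOfLength n (z₁, r, y₂) w (z₁ ++ y₂, rf, []) →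
        (T₁.product T₂).Run (pairConfig (if T₂.pol r = -1 then e else e') r) w
          (pairConfig cf rf)) →
      (T₁.product T₂).Run (pairConfig (if -T₂.pol r = -1 then e else e') r) w
        (pairConfig cf rf) := by
    intro e e' z₁ v y₂ r w hz₁ hs hy₂ hrun hnil
    obtain ⟨r', w₁, w₂, m, hr', hm, rfl, hmn, hmeq⟩ : ∃ r' w₁ w₂ m,
        T₂.Run (atEnd [] v [] (r, -T₂.pol r)) w₁ (atEnd [] v [] (r', T₂.pol r')) ∧
        T₂.RunOfLength m (atEnd z₁ v y₂ (r', T₂.pol r')) w₂ (z₁ ++ v ++ y₂, rf, []) ∧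
        w = w₁ ++ w₂ ∧ m ≤ n ∧
        (m = n → atEnd [] v [] (r, -T₂.pol r) = atEnd [] v [] (r', T₂.pol r')) := by
      rcases Int.units_eq_one_or (T₂.pol r) with hp | hp
      · have := RunOfLength.exists_exit (z := z₁) (a := []) (b := v) (y := y₂) (r := r)
          (by simpa [hp] using hrun) hrf
        simpa [hp] using this
      · have := RunOfLength.exists_exit (z := z₁) (a := v) (b := []) (y := y₂) (r := r)
          (by simpa [hp] using hrun) hrf
        simpa [hp] using this
    have hstep : (T₁.product T₂).Step (pairConfig (if -T₂.pol r = -1 then e else e') r) w₁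
        (pairConfig (if T₂.pol r' = -1 then e else e') r') :=
      product_step_iff.2 ⟨e, v, e', r, r', hs, hr', rfl, rfl⟩
    refine .head _ _ _ _ _ hstep ?_
    rcases hmn.lt_or_eq with hlt | rfl
    · rcases Int.units_eq_one_or (T₂.pol r') with hp | hp
      · simp only [hp, show (1 : ℤˣ) ≠ -1 by decide, if_false]
        exact ih m hlt (hz₁.tail hs) hy₂ (by simpa [hp] using hm)
      · simp only [hp, if_true]
        exact ih m hlt hz₁ (.head _ _ _ _ _ hs hy₂) (by simpa [hp] using hm)
    · have heq := hmeq rfl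
      obtain rfl : r = r' := by simpa only [atEnd_state] using congrArg (fun c => c.2.1) heq
      obtain rfl : v = [] := by
        rcases Int.units_eq_one_or (T₂.pol r) with hp | hp <;> simpa [hp, eq_comm] using heq
      obtain rfl : w₁ = [] := by
        rw [heq] at hr'
        obtain ⟨h, -⟩ | ⟨_, _, _, hs, -⟩ := hr'.eq_or_head
        · exact h
        · exact ((T₂.isExit_atEnd _ _).not_step hs).elim
      refine hnil rfl ?_
      rcases Int.units_eq_one_or (T₂.pol r) with hp | hp <;> simpa [hp] using hm
  rcases Int.units_eq_one_or (T₂.pol r) with hp | hp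
  · induction hy generalizing z with
    | refl c =>
      have hx : T₂.IsExit (z, r, []) := by simpa [hp] using T₂.isExit_atEnd z r
      generalize hd : (z ++ [], rf, ([] : List (TapeSymbol B))) = d at h
      cases h with
      | refl =>
        obtain rfl : rf = r := congrArg (fun c => c.2.1) hd
        exact .refl _
      | head hs _ => exact (hx.not_step hs).elim
    | head c e cf v y hs hy ihy =>
      have := cross (r := r) (w := w) hz hs hy (by simpa [hp] using h) (by
        rintro rfl h'
        simp only [hp, show (1 : ℤˣ) ≠ -1 by decide, if_false]
        exact ihy ih (by simpa using hz.tail hs) h' cross)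
      simpa [hp] using this
  · revert y w
    refine hz.tail_induction (P := fun z c => ∀ {y w}, T₁.marked.Run c y cf →
      T₂.RunOfLength n (z, r, y) w (z ++ y, rf, []) →
      (T₁.product T₂).Run (pairConfig c r) w (pairConfig cf rf)) ?_ ?_
    · intro y w _ h
      have hx : T₂.IsExit ([], r, y) := by simpa [hp] using T₂.isExit_atEnd y r
      generalize hd : ([] ++ y, rf, ([] : List (TapeSymbol B))) = d at h
      cases h with
      | refl =>
        obtain rfl : rf = r := congrArg (fun c => c.2.1) hd
        exact absurd (hp.symm.trans hrf) (by decide)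
      | head hs _ => exact (hx.not_step hs).elim
    · intro z e v e' hz hs ihz y w hy h
      have := cross (r := r) (w := w) hz hs hy (by simpa [hp] using h) (by
        rintro rfl h'
        simp only [hp, if_true]
        exact ihz (by simpa using Run.head _ _ _ _ _ hs hy) h')
      simpa [hp] using this

theorem product_realizes_iff (h₁ : T₁.IsReversible) (x : List A) (w : List C) :
    (T₁.product T₂).Realizes x w ↔ ∃ v, T₁.Realizes x v ∧ T₂.Realizes v w := by
  constructor
  · rintro ⟨⟨q, r⟩, ⟨hq, hr⟩, h⟩
    obtain ⟨c, r, z, y, c', hc, hz, hy, hrun⟩ := exists_runs_of_product_run h₁ h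
    obtain ⟨c1, c2, c3⟩ := c
    simp only [pairConfig, Prod.mk.injEq] at hc
    obtain ⟨rfl, ⟨rfl, rfl⟩, rfl⟩ := hc
    have hp := T₁.marked.forward_of_run_to_rightmost (by simp [tape]) hz
    have hx : T₁.marked.IsExit (tape x, q, []) := by
      simpa [hp] using T₁.marked.isExit_atEnd (tape x) q
    obtain ⟨rfl, rfl⟩ | ⟨_, _, _, hs, -⟩ := hy.eq_or_head
    · obtain ⟨v, rfl, hv⟩ := (T₁.marked_run_iff h₁ hq).1 hz
      exact ⟨v, ⟨q, hq, hv⟩, r, hr, by simpa using hrun⟩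
    · exact (hx.not_step hs).elim
  · rintro ⟨v, ⟨q, hq, hv⟩, r, hr, h⟩
    obtain ⟨n, hn⟩ := h.exists_length
    exact ⟨(q, r), ⟨hq, hr⟩, product_run_of_runs (c := ([], T₁.init, tape x))
      (cf := (tape x, q, [])) (T₂.forward_of_run_to_rightmost (by simp [tape]) h) (.refl _)
      ((T₁.marked_run_iff h₁ hq).2 ⟨v, rfl, hv⟩) hn⟩

end Composition

/-! ### Planarity of runs through a word -/

section WordPlanarity

variable {T : TwoWayTransducer A B Q}

/-- The edge of a run of `T` that crosses the word `y`: its first configuration is at the end `p` of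
`y`, facing inwards, and its last configuration at the end `p'`, facing outwards. -/
def WordEdge (T : TwoWayTransducer A B Q) (y : List (TapeSymbol A)) (p p' : Q × ℤˣ) : Prop :=
  ∃ r r' w, T.Run (atEnd [] y [] (r, -T.pol r)) w (atEnd [] y [] (r', T.pol r')) ∧
    p = (r, -T.pol r) ∧ p' = (r', T.pol r')

/-- The configurations on a run from `c` to `d`. -/
def visited (T : TwoWayTransducer A B Q) (c d : List (TapeSymbol A) × Q × List (TapeSymbol A)) :
    Set (List (TapeSymbol A) × Q × List (TapeSymbol A)) :=
  {e | ∃ w w', T.Run c w e ∧ T.Run e w' d}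

open Classical in
/-- The parity of the number of configurations of `P` that are at the same position of the tape as
`e` and have a smaller state. -/
noncomputable def parityBelow [Fintype Q] (lt : Q → Q → Prop)
    (P : Set (List (TapeSymbol A) × Q × List (TapeSymbol A)))
    (e : List (TapeSymbol A) × Q × List (TapeSymbol A)) : ZMod 2 :=
  (Finset.univ.filter fun r => (e.1, r, e.2.2) ∈ P ∧ lt r e.2.1).card

open Classical in
theorem card_atEnd_mem_eq_parityBelow [Fintype Q] (lt : Q → Q → Prop)
    (P : Set (List (TapeSymbol A) × Q × List (TapeSymbol A))) (u x v : List (TapeSymbol A))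
    (k : Q × ℤˣ) :
    (((Finset.univ.filter fun p => atEnd u x v p ∈ P).filter
      fun p => p.2 = k.2 ∧ lt p.1 k.1).card : ZMod 2) = parityBelow lt P (atEnd u x v k) := by
  unfold parityBelow
  congr 1
  have key : ∀ r : Q, atEnd u x v (r, k.2) = ((atEnd u x v k).1, r, (atEnd u x v k).2.2) := by
    intro r; unfold atEnd; split_ifs <;> rfl
  refine Finset.card_bij' (fun p _ => p.1) (fun r _ => (r, k.2)) ?_ ?_ ?_ ?_
  · rintro ⟨p, σ⟩ h
    simp only [Finset.mem_filter, Finset.mem_univ, true_and] at h ⊢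
    obtain ⟨h1, rfl, h3⟩ := h
    rw [atEnd_state, ← key]
    exact ⟨h1, h3⟩
  · intro r h
    simp only [Finset.mem_filter, Finset.mem_univ, true_and, atEnd_state, ← key] at h ⊢
    exact h
  · rintro ⟨p, σ⟩ h
    simp only [Finset.mem_filter, Finset.mem_univ, true_and] at h
    simp [h.2.1]
  · intro r _
    rfl

/-- An edge of a transition profile, without its orientation. -/
def ProfileEdge (T : TwoWayTransducer A B Q) (a : TapeSymbol A) (p p' : Q × ℤˣ) : Prop :=
  (transitionProfile T.pol (T.forget a)).Adj p p' ∨ (transitionProfile T.pol (T.forget a)).Adj p' p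

theorem profileEdge_of_mem {a : TapeSymbol A} {q r : Q} {w : List B} (h : (q, w, r) ∈ T.δ a) :
    T.ProfileEdge a (q, -T.pol q) (r, T.pol r) :=
  .inl ⟨q, r, ⟨w, h⟩, rfl, rfl⟩

theorem ProfileEdge.symm {a : TapeSymbol A} {p p' : Q × ℤˣ} (h : T.ProfileEdge a p p') :
    T.ProfileEdge a p' p := Or.symm h

theorem not_profileEdge_self {a : TapeSymbol A} (p : Q × ℤˣ) : ¬ T.ProfileEdge a p p := by
  have key : ¬ (transitionProfile T.pol (T.forget a)).Adj p p := by
    rintro ⟨q, r, -, rfl, h⟩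
    obtain ⟨rfl, h⟩ := Prod.mk.inj h
    exact units_ne_neg_self (T.pol q) h.symm
  exact fun h => h.elim key key

theorem ProfileEdge.unique (hT : T.IsReversible) {a : TapeSymbol A} {p p' p'' : Q × ℤˣ}
    (h : T.ProfileEdge a p p') (h' : T.ProfileEdge a p p'') : p' = p'' := by
  rcases h with ⟨q, r, ⟨w, h⟩, rfl, rfl⟩ | ⟨q, r, ⟨w, h⟩, rfl, rfl⟩ <;>
  rcases h' with ⟨q', r', ⟨w', h'⟩, h1, rfl⟩ | ⟨q', r', ⟨w', h'⟩, rfl, h1⟩ <;>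
  obtain ⟨rfl, h2⟩ := Prod.mk.inj h1
  · obtain rfl := (hT.1 _ _ _ _ _ _ h h').2; rfl
  · exact (units_ne_neg_self (T.pol q) h2.symm).elim
  · exact (units_ne_neg_self (T.pol r) h2).elim
  · obtain rfl := hT.2 _ _ _ _ _ _ h h'; rfl

theorem PlanarOn.false_of_crossing {S : Set (TapeSymbol A)} {lt : Q → Q → Prop}
    (h : T.PlanarOn S lt) {a : TapeSymbol A} (ha : a ∈ S) {u r v s : Q × ℤˣ}
    (h1 : vertexLT lt u r) (h2 : vertexLT lt r v) (h3 : vertexLT lt v s)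
    (h4 : T.ProfileEdge a u v) (h5 : T.ProfileEdge a r s) : False :=
  h a ha ⟨u, r, v, s, h1, h2, h3, h4, h5⟩

/-- On a run from an entry to an exit configuration, each configuration next to the letter `a` has
a step of the run through `a`. -/
theorem exists_profileEdge_of_visited {c d : List (TapeSymbol A) × Q × List (TapeSymbol A)}
    (hc : T.IsEntry c) (hd : T.IsExit d) {u v : List (TapeSymbol A)} {a : TapeSymbol A}
    {p : Q × ℤˣ} (hp : atEnd u [a] v p ∈ T.visited c d) :
    ∃ p', atEnd u [a] v p' ∈ T.visited c d ∧ T.ProfileEdge a p p' := by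
  obtain ⟨w, w', h, h'⟩ := hp
  obtain ⟨p, σ⟩ := p
  obtain rfl | rfl : σ = T.pol p ∨ σ = -T.pol p := by
    rcases Int.units_eq_one_or (T.pol p) with h | h <;>
    rcases Int.units_eq_one_or σ with h' | h' <;> simp [h, h']
  · obtain ⟨-, rfl⟩ | ⟨w₁, e, w₂, hr, hs, rfl⟩ := h.eq_or_tail
    · exact (hc _ _ _ _ rfl).elim
    · obtain ⟨u', a', v', q, r, hδ, rfl, he⟩ := T.step_iff.1 hs
      obtain ⟨rfl, rfl, rfl, rfl⟩ := atEnd_singleton_injective (f := T.pol) he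
      exact ⟨(q, -T.pol q), ⟨w₁, _, hr, .head _ _ _ _ _ hs h'⟩, (profileEdge_of_mem hδ).symm⟩
  · obtain ⟨-, rfl⟩ | ⟨w₁, e, w₂, hs, hr, rfl⟩ := h'.eq_or_head
    · exact (hd _ _ _ _ rfl).elim
    · obtain ⟨u', a', v', q, r, hδ, he, rfl⟩ := T.step_iff.1 hs
      obtain ⟨rfl, rfl, rfl, rfl⟩ := atEnd_singleton_injective (f := fun q => -T.pol q) he
      exact ⟨(r, T.pol r), ⟨_, w₂, h.tail hs, hr⟩, profileEdge_of_mem hδ⟩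

theorem not_mem_visited_of_step (hT : T.IsReversible)
    {c d e e' : List (TapeSymbol A) × Q × List (TapeSymbol A)} (hc : T.IsEntry c) {w : List B}
    (hs : T.Step e w e') (he : e ∉ T.visited c d) : e' ∉ T.visited c d := by
  rintro ⟨w₁, w₂, h, h'⟩
  obtain ⟨-, rfl⟩ | ⟨v₁, e'', v₂, hr, hs', rfl⟩ := h.eq_or_tail
  · exact hc.not_step hs
  · obtain ⟨rfl, rfl⟩ := hs.codeterministic hT hs'
    exact he ⟨v₁, _, hr, .head _ _ _ _ _ hs h'⟩

/-- The parity with respect to a run is constant along any disjoint run. -/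
theorem parityBelow_eq_of_run [Fintype Q] (hT : T.IsReversible) {S : Set (TapeSymbol A)}
    {lt : Q → Q → Prop} [IsStrictTotalOrder Q lt] (hpl : T.PlanarOn S lt)
    {c d e f : List (TapeSymbol A) × Q × List (TapeSymbol A)} (hc : T.IsEntry c) (hd : T.IsExit d)
    {w : List B} (h : T.Run e w f) (he : e ∉ T.visited c d) (hS : ∀ a ∈ e.1 ++ e.2.2, a ∈ S) :
    parityBelow lt (T.visited c d) e = parityBelow lt (T.visited c d) f ∧
      f ∉ T.visited c d := by
  classical
  induction h with
  | refl => exact ⟨rfl, he⟩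
  | head e g f w w' hs hr ih =>
    have hg := not_mem_visited_of_step hT hc hs he
    refine (ih hg ?_).imp_left (Eq.trans ?_)
    · rwa [hs.run.tape_eq] at hS
    · obtain ⟨u, a, v, q, r, hδ, rfl, rfl⟩ := T.step_iff.1 hs
      rw [atEnd_tape] at hS
      have ha : a ∈ S := hS a (by simp)
      set X := Finset.univ.filter fun p => atEnd u [a] v p ∈ T.visited c d
      have hq : (q, -T.pol q) ∉ X := by simpa [X] using he
      have hr : (r, T.pol r) ∉ X := by simpa [X] using hg
      have key := card_below_eq_of_edge (isStrictTotalOrder_vertexLT lt) (E := T.ProfileEdge a)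
        ProfileEdge.symm not_profileEdge_self (ProfileEdge.unique hT)
        (hpl.false_of_crossing ha) (S := X)
        (by
          intro p hp
          obtain ⟨p', h, h'⟩ := exists_profileEdge_of_visited hc hd
            (by simpa [X] using hp : atEnd u [a] v p ∈ T.visited c d)
          exact ⟨p', by simpa [X] using h, h'⟩)
        hq (profileEdge_of_mem hδ)
      rw [card_below_eq_add hq, card_below_eq_add hr, card_atEnd_mem_eq_parityBelow,
        card_atEnd_mem_eq_parityBelow] at key
      exact add_left_cancel key

theorem eq_or_eq_of_mem_visited {y : List (TapeSymbol A)} {r r' : Q} {p : Q × ℤˣ}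
    (h : atEnd [] y [] p ∈
      T.visited (atEnd [] y [] (r, -T.pol r)) (atEnd [] y [] (r', T.pol r'))) :
    p = (r, -T.pol r) ∨ p = (r', T.pol r') := by
  obtain ⟨w, w', h, h'⟩ := h
  obtain ⟨p, σ⟩ := p
  obtain rfl | rfl : σ = T.pol p ∨ σ = -T.pol p := by
    rcases Int.units_eq_one_or (T.pol p) with h | h <;>
    rcases Int.units_eq_one_or σ with h' | h' <;> simp [h, h']
  · obtain ⟨-, he⟩ | ⟨_, _, _, hs, -⟩ := h'.eq_or_head
    · obtain rfl : p = r' := by simpa only [atEnd_state] using congrArg (fun c => c.2.1) he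
      exact .inr rfl
    · exact ((T.isExit_atEnd y p).not_step hs).elim
  · obtain ⟨-, he⟩ | ⟨_, _, _, -, hs, -⟩ := h.eq_or_tail
    · obtain rfl : r = p := by simpa only [atEnd_state] using congrArg (fun c => c.2.1) he
      exact .inl rfl
    · exact ((T.isEntry_atEnd y p).not_step hs).elim

/-- If the transitions on all symbols of `y` are planar, then the runs through `y` do not cross:
the parity with respect to the run between `r` and `s` would be different at `u` and at `v`. -/
theorem wordEdge_not_crossing (hT : T.IsReversible) {S : Set (TapeSymbol A)}
    {lt : Q → Q → Prop} [IsStrictTotalOrder Q lt] (hpl : T.PlanarOn S lt)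
    {y : List (TapeSymbol A)} (hy : ∀ a ∈ y, a ∈ S) {u r v s : Q × ℤˣ}
    (hur : vertexLT lt u r) (hrv : vertexLT lt r v) (hvs : vertexLT lt v s)
    (huv : T.WordEdge y u v ∨ T.WordEdge y v u) (hrs : T.WordEdge y r s ∨ T.WordEdge y s r) :
    False := by
  classical
  have := T.finite_states
  have := Fintype.ofFinite Q
  have := isStrictTotalOrder_vertexLT lt
  obtain ⟨c, d, hc, hd, hmem, hr⟩ : ∃ c d, T.IsEntry c ∧ T.IsExit d ∧
      (∀ p, atEnd [] y [] p ∈ T.visited c d → p = r ∨ p = s) ∧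
      atEnd [] y [] r ∈ T.visited c d := by
    rcases hrs with ⟨k, l, w, hrun, rfl, rfl⟩ | ⟨k, l, w, hrun, rfl, rfl⟩
    · exact ⟨_, _, T.isEntry_atEnd y k, T.isExit_atEnd y l, fun p => eq_or_eq_of_mem_visited,
        _, _, .refl _, hrun⟩
    · exact ⟨_, _, T.isEntry_atEnd y k, T.isExit_atEnd y l,
        fun p hp => (eq_or_eq_of_mem_visited hp).symm, _, _, hrun, .refl _⟩
  have hus := trans_of (vertexLT lt) (trans_of (vertexLT lt) hur hrv) hvs
  have hrs' := trans_of (vertexLT lt) hrv hvs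
  have hu : atEnd [] y [] u ∉ T.visited c d := fun h =>
    (hmem u h).elim (ne_of_irrefl hur) (ne_of_irrefl hus)
  have hv : atEnd [] y [] v ∉ T.visited c d := fun h =>
    (hmem v h).elim (ne_of_irrefl' hrv) (ne_of_irrefl hvs)
  have hpar : parityBelow lt (T.visited c d) (atEnd [] y [] u) =
      parityBelow lt (T.visited c d) (atEnd [] y [] v) := by
    rcases huv with ⟨k, l, w, hrun, rfl, rfl⟩ | ⟨k, l, w, hrun, rfl, rfl⟩
    · exact (parityBelow_eq_of_run hT hpl hc hd hrun hu (by rwa [atEnd_tape, List.append_nil])).1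
    · exact (parityBelow_eq_of_run hT hpl hc hd hrun hv
        (by rwa [atEnd_tape, List.append_nil])).1.symm
  set X := Finset.univ.filter fun p => atEnd [] y [] p ∈ T.visited c d
  have hXu : u ∉ X := by simpa [X] using hu
  have hXv : v ∉ X := by simpa [X] using hv
  have hu0 : X.filter (vertexLT lt · u) = ∅ := by
    refine Finset.filter_eq_empty_iff.2 fun p hp hpu => ?_
    rcases hmem p (by simpa [X] using hp) with rfl | rfl
    · exact asymm_of (vertexLT lt) hur hpu
    · exact asymm_of (vertexLT lt) hus hpu
  have hv1 : X.filter (vertexLT lt · v) = {r} := by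
    ext p
    simp only [Finset.mem_filter, Finset.mem_singleton]
    constructor
    · rintro ⟨hp, hpv⟩
      rcases hmem p (by simpa [X] using hp) with rfl | rfl
      · rfl
      · exact (asymm_of (vertexLT lt) hvs hpv).elim
    · rintro rfl
      exact ⟨by simpa [X] using hr, hrv⟩
  have h1 := card_below_eq_add (lt := lt) hXu
  have h2 := card_below_eq_add (lt := lt) hXv
  rw [card_atEnd_mem_eq_parityBelow, hu0] at h1
  rw [card_atEnd_mem_eq_parityBelow, hv1, ← hpar, ← h1] at h2
  simp at h2

end WordPlanarity

/-! ### Planarity of the product -/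

section ProductPlanarity

variable {T₁ : TwoWayTransducer A B Q} {T₂ : TwoWayTransducer B C R}

/-- The end (`σ = -1` for `q`, `σ = 1` for `q'`) of the edge of a transition `(q, v, q')`. -/
def edgeEnd (T : TwoWayTransducer A B Q) (q q' : Q) (σ : ℤˣ) : Q × ℤˣ :=
  if σ = -1 then (q, -T.pol q) else (q', T.pol q')

/-- The edges of the product arise by replacing each edge of `T₁` with output `y` by the word
edges of `y` in `T₂`: the vertex of the product for a vertex of such a word edge. -/
def productVertex (T : TwoWayTransducer A B Q) (q q' : Q) (p : R × ℤˣ) : (Q × R) × ℤˣ :=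
  (((T.edgeEnd q q' p.2).1, p.1), (T.edgeEnd q q' p.2).2)

theorem edgeEnd_profileEdge {x : TapeSymbol A} {q q' : Q} {v : List (TapeSymbol B)}
    (h : (q, v, q') ∈ T₁.markedδ x) {σ τ : ℤˣ} (hστ : σ ≠ τ) :
    T₁.ProfileEdge x (T₁.edgeEnd q q' σ) (T₁.edgeEnd q q' τ) := by
  obtain ⟨w, h, -⟩ := h
  have := profileEdge_of_mem h
  rcases Int.units_eq_one_or σ with rfl | rfl <;> rcases Int.units_eq_one_or τ with rfl | rfl
  · exact (hστ rfl).elim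
  · simpa [edgeEnd, show (1 : ℤˣ) ≠ -1 by decide] using this.symm
  · simpa [edgeEnd, show (1 : ℤˣ) ≠ -1 by decide] using this
  · exact (hστ rfl).elim

/-- Distinct edges of a reversible transducer have no common end. -/
theorem eq_of_edgeEnd_eq (hT : T₁.IsReversible) {x : TapeSymbol A} {q q' k k' : Q}
    {v y : List (TapeSymbol B)} (h : (q, v, q') ∈ T₁.markedδ x) (h' : (k, y, k') ∈ T₁.markedδ x)
    {σ τ : ℤˣ} (he : T₁.edgeEnd q q' σ = T₁.edgeEnd k k' τ) : q = k ∧ v = y ∧ q' = k' := by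
  by_cases hστ : σ = τ
  · subst hστ
    refine hT.marked.eq_of_end h h' σ ?_
    unfold edgeEnd at he
    split_ifs at he ⊢ <;> exact congrArg Prod.fst he
  · exfalso
    unfold edgeEnd at he
    rcases Int.units_eq_one_or σ with rfl | rfl <;>
    rcases Int.units_eq_one_or τ with rfl | rfl <;>
    simp [show (1 : ℤˣ) ≠ -1 by decide] at he hστ
    · obtain ⟨rfl, he⟩ := he
      exact units_ne_neg_self _ he
    · obtain ⟨rfl, he⟩ := he
      exact units_ne_neg_self _ he.symm

theorem exists_wordEdge_of_profileEdge {x : TapeSymbol A} {X Y : (Q × R) × ℤˣ}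
    (h : (T₁.product T₂).ProfileEdge x X Y) :
    ∃ q v q' p p', (q, v, q') ∈ T₁.markedδ x ∧ (T₂.WordEdge v p p' ∨ T₂.WordEdge v p' p) ∧
      X = T₁.productVertex q q' p ∧ Y = T₁.productVertex q q' p' := by
  have key : ∀ {X Y : (Q × R) × ℤˣ},
      (transitionProfile (T₁.product T₂).pol ((T₁.product T₂).forget x)).Adj X Y →
      ∃ q v q' p p', (q, v, q') ∈ T₁.markedδ x ∧ T₂.WordEdge v p p' ∧
        X = T₁.productVertex q q' p ∧ Y = T₁.productVertex q q' p' := by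
    rintro X Y ⟨s, s', ⟨w, h⟩, rfl, rfl⟩
    obtain ⟨q, v, q', r, r', hδ, hrun, rfl, rfl⟩ := productTransition_iff.1 h
    refine ⟨q, v, q', _, _, hδ, ⟨r, r', w, hrun, rfl, rfl⟩, ?_, ?_⟩
    · rcases Int.units_eq_one_or (T₂.pol r) with hr | hr <;>
      simp [productVertex, edgeEnd, product, hr, show (1 : ℤˣ) ≠ -1 by decide]
    · rcases Int.units_eq_one_or (T₂.pol r') with hr | hr <;>
      simp [productVertex, edgeEnd, product, hr, show (1 : ℤˣ) ≠ -1 by decide]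
  rcases h with h | h
  · obtain ⟨q, v, q', p, p', h1, h2, h3, h4⟩ := key h
    exact ⟨q, v, q', p, p', h1, .inl h2, h3, h4⟩
  · obtain ⟨q, v, q', p, p', h1, h2, h3, h4⟩ := key h
    exact ⟨q, v, q', p', p, h1, .inr h2, h4, h3⟩

variable {lt₁ : Q → Q → Prop} {lt₂ : R → R → Prop}

/-- The order of the product refines the order of `T₁`. -/
theorem vertexLT_fst_or_eq {pol : Q → ℤˣ} {X Y : (Q × R) × ℤˣ}
    (h : vertexLT (directedLex pol lt₁ lt₂) X Y) :
    vertexLT lt₁ (X.1.1, X.2) (Y.1.1, Y.2) ∨ (X.1.1, X.2) = (Y.1.1, Y.2) := by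
  obtain ⟨⟨q, r⟩, σ⟩ := X
  obtain ⟨⟨q', r'⟩, τ⟩ := Y
  simp only [vertexLT, directedLex, Prod.mk.injEq] at h ⊢
  rcases h with h | ⟨h | h, rfl, rfl⟩ | ⟨h | h, rfl, rfl⟩
  · exact .inl (.inl h)
  · exact .inl (.inr (.inl ⟨h, rfl, rfl⟩))
  · exact .inr ⟨h.1, rfl⟩
  · exact .inl (.inr (.inr ⟨h, rfl, rfl⟩))
  · exact .inr ⟨h.1.symm, rfl⟩

/-- Among the product vertices over a single edge of `T₁`, those over the same end are ordered as
the corresponding vertices of `T₂`, whatever the directions of the states of `T₁`. This is what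
the reversal of the order in `directedLex` is for. -/
theorem vertexLT_productVertex [IsStrictTotalOrder Q lt₁] {q q' : Q} {p p' : R × ℤˣ}
    (h : vertexLT (directedLex T₁.pol lt₁ lt₂) (T₁.productVertex q q' p)
      (T₁.productVertex q q' p')) :
    (p.2 = p'.2 ∧ vertexLT lt₂ p p') ∨
      (p.2 ≠ p'.2 ∧ (vertexLT lt₁ (T₁.edgeEnd q q' p.2) (T₁.edgeEnd q q' p'.2) ∨
        T₁.edgeEnd q q' p.2 = T₁.edgeEnd q q' p'.2)) := by
  by_cases hp : p.2 = p'.2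
  · refine .inl ⟨hp, ?_⟩
    obtain ⟨r, σ⟩ := p
    obtain ⟨r', τ⟩ := p'
    obtain rfl : σ = τ := hp
    have hq := irrefl_of lt₁ q
    have hq' := irrefl_of lt₁ q'
    rcases Int.units_eq_one_or σ with rfl | rfl <;>
    rcases Int.units_eq_one_or (T₁.pol q) with h1 | h1 <;>
    rcases Int.units_eq_one_or (T₁.pol q') with h2 | h2 <;>
    simpa [vertexLT, productVertex, edgeEnd, directedLex, h1, h2, hq, hq',
      show (1 : ℤˣ) ≠ -1 by decide, show (-1 : ℤˣ) ≠ 1 by decide] using h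
  · exact .inr ⟨hp, vertexLT_fst_or_eq h⟩

/-- Two edges of the product over the same edge of `T₁` do not cross. Depending on the order of the
ends of that edge, the order of the product is the one of `T₂` or a rotation of it, and crossing
is invariant under rotations. -/
theorem not_crossing_of_same_edge (h₂ : T₂.IsReversible)
    [IsStrictTotalOrder Q lt₁] [IsStrictTotalOrder R lt₂] {S : Set (TapeSymbol B)}
    (hpl : T₂.PlanarOn S lt₂) {x : TapeSymbol A} {q q' : Q} {y : List (TapeSymbol B)}
    (hδ : (q, y, q') ∈ T₁.markedδ x) (hy : ∀ b ∈ y, b ∈ S) {u r v s : R × ℤˣ}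
    (hur : vertexLT (directedLex T₁.pol lt₁ lt₂) (T₁.productVertex q q' u)
      (T₁.productVertex q q' r))
    (hrv : vertexLT (directedLex T₁.pol lt₁ lt₂) (T₁.productVertex q q' r)
      (T₁.productVertex q q' v))
    (hvs : vertexLT (directedLex T₁.pol lt₁ lt₂) (T₁.productVertex q q' v)
      (T₁.productVertex q q' s))
    (huv : T₂.WordEdge y u v ∨ T₂.WordEdge y v u) (hrs : T₂.WordEdge y r s ∨ T₂.WordEdge y s r) :
    False := by
  have := isStrictTotalOrder_vertexLT lt₁
  have hne : T₁.edgeEnd q q' (-1) ≠ T₁.edgeEnd q q' 1 := by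
    intro h
    have := edgeEnd_profileEdge hδ (σ := -1) (τ := 1) (by decide)
    rw [h] at this
    exact not_profileEdge_self _ this
  have cross := @wordEdge_not_crossing B C R T₂ h₂ S lt₂ _ hpl y hy
  have hur := vertexLT_productVertex hur
  have hrv := vertexLT_productVertex hrv
  have hvs := vertexLT_productVertex hvs
  have hlt : ∀ {p p' : R × ℤˣ}, p.2 = -1 → p'.2 = 1 → vertexLT lt₂ p p' :=
    fun h h' => .inl ⟨h, h'⟩
  have hσ := fun p : R × ℤˣ => Int.units_eq_one_or p.2
  rcases trichotomous_of (vertexLT lt₁) (T₁.edgeEnd q q' (-1)) (T₁.edgeEnd q q' 1) with h | h | h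
  · have key : ∀ {p p' : R × ℤˣ}, (p.2 = p'.2 ∧ vertexLT lt₂ p p') ∨
        (p.2 ≠ p'.2 ∧ (vertexLT lt₁ (T₁.edgeEnd q q' p.2) (T₁.edgeEnd q q' p'.2) ∨
          T₁.edgeEnd q q' p.2 = T₁.edgeEnd q q' p'.2)) → vertexLT lt₂ p p' := by
      intro p p' hpp
      have := asymm_of (vertexLT lt₁) h
      rcases hσ p with hp | hp <;> rcases hσ p' with hp' | hp' <;> grind
    exact cross (key hur) (key hrv) (key hvs) huv hrs
  · exact hne h
  · have key : ∀ {p p' : R × ℤˣ}, (p.2 = p'.2 ∧ vertexLT lt₂ p p') ∨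
        (p.2 ≠ p'.2 ∧ (vertexLT lt₁ (T₁.edgeEnd q q' p.2) (T₁.edgeEnd q q' p'.2) ∨
          T₁.edgeEnd q q' p.2 = T₁.edgeEnd q q' p'.2)) →
        (p.2 = p'.2 ∧ vertexLT lt₂ p p') ∨ (p.2 = 1 ∧ p'.2 = -1) := by
      intro p p' hpp
      have := asymm_of (vertexLT lt₁) h
      rcases hσ p with hp | hp <;> rcases hσ p' with hp' | hp' <;> grind
    have h1 : (1 : ℤˣ) ≠ -1 := by decide
    rcases key hur with ⟨eur, hur⟩ | ⟨hu, hr⟩ <;> rcases key hrv with ⟨erv, hrv⟩ | ⟨hr', hv⟩ <;>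
    rcases key hvs with ⟨evs, hvs⟩ | ⟨hv', hs⟩
    · exact cross hur hrv hvs huv hrs
    · exact cross (hlt hs (by rw [eur, erv, hv'])) hur hrv hrs.symm huv
    · exact cross hvs (hlt (evs ▸ hv) (eur.trans hr')) hur huv.symm hrs.symm
    · exact h1 (hv'.symm.trans hv)
    · exact cross hrv hvs (hlt (by rw [← evs, ← erv, hr]) hu) hrs huv.symm
    · exact h1 (hv'.symm.trans (erv ▸ hr))
    · exact h1 (hr'.symm.trans hr)
    · exact h1 (hr'.symm.trans hr)

/-- Planarity on a set `S₁` of input symbols of the product, if `T₂` is planar on all symbols that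
occur in the marked outputs of `T₁` on `S₁`. -/
theorem product_planarOn (h₁ : T₁.IsReversible) (h₂ : T₂.IsReversible)
    [IsStrictTotalOrder Q lt₁] [IsStrictTotalOrder R lt₂] {S₁ : Set (TapeSymbol A)}
    {S₂ : Set (TapeSymbol B)} (hpl₁ : T₁.PlanarOn S₁ lt₁) (hpl₂ : T₂.PlanarOn S₂ lt₂)
    (hS : ∀ x ∈ S₁, ∀ q y q', (q, y, q') ∈ T₁.markedδ x → ∀ b ∈ y, b ∈ S₂) :
    (T₁.product T₂).PlanarOn S₁ (directedLex T₁.pol lt₁ lt₂) := by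
  rintro x hx ⟨u, r, v, s, hur, hrv, hvs, huv, hrs⟩
  obtain ⟨q, y, q', u, v, hq, huv', rfl, rfl⟩ := exists_wordEdge_of_profileEdge huv
  obtain ⟨k, z, k', r, s, hk, hrs', rfl, rfl⟩ := exists_wordEdge_of_profileEdge hrs
  by_cases he : ∃ σ τ, T₁.edgeEnd q q' σ = T₁.edgeEnd k k' τ
  · obtain ⟨σ, τ, he⟩ := he
    obtain ⟨rfl, rfl, rfl⟩ := eq_of_edgeEnd_eq h₁ hq hk he
    exact not_crossing_of_same_edge h₂ hpl₂ hq (hS x hx _ _ _ hq) hur hrv hvs huv'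
      hrs'
  · -- over distinct edges of `T₁`, a crossing projects to a crossing of these edges
    push Not at he
    have := isStrictTotalOrder_vertexLT lt₁
    have hur' : vertexLT lt₁ (T₁.edgeEnd q q' u.2) (T₁.edgeEnd k k' r.2) :=
      (vertexLT_fst_or_eq hur).resolve_right (he _ _)
    have hrv' : vertexLT lt₁ (T₁.edgeEnd k k' r.2) (T₁.edgeEnd q q' v.2) :=
      (vertexLT_fst_or_eq hrv).resolve_right (he _ _).symm
    have hvs' : vertexLT lt₁ (T₁.edgeEnd q q' v.2) (T₁.edgeEnd k k' s.2) :=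
      (vertexLT_fst_or_eq hvs).resolve_right (he _ _)
    refine hpl₁.false_of_crossing hx hur' hrv' hvs' (edgeEnd_profileEdge hq fun h => ?_)
      (edgeEnd_profileEdge hk fun h => ?_)
    · rw [← h] at hrv'
      exact asymm_of _ hur' hrv'
    · rw [← h] at hvs'
      exact asymm_of _ hrv' hvs'

end ProductPlanarity

end TwoWayTransducer

theorem mainTheorem5 {A B C Q R : Type*}
    (T₁ : TwoWayTransducer A B Q) (T₂ : TwoWayTransducer B C R)
    (hrev₁ : T₁.IsReversible) (hpl₁ : T₁.IsPlanar)
    (hrev₂ : T₂.IsReversible) (hpl₂ : T₂.IsPlanar) :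
    ∃ T : TwoWayTransducer A C (Q × R),
      T.IsReversible ∧ T.IsPlanar ∧
      (∀ (u : List A) (w : List C),
        T.Realizes u w ↔ ∃ v : List B, T₁.Realizes u v ∧ T₂.Realizes v w) ∧
      T = T₁.product T₂ ∧
      ∀ (lt₁ : Q → Q → Prop) (lt₂ : R → R → Prop),
        IsStrictTotalOrder Q lt₁ → IsStrictTotalOrder R lt₂ →
        IsStrictTotalOrder (Q × R) (directedLex T₁.pol lt₁ lt₂) ∧
        (T₁.PlanarOn (Set.range TapeSymbol.letter) lt₁ →
          T₂.PlanarOn (Set.range TapeSymbol.letter) lt₂ →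
          T.PlanarOn (Set.range TapeSymbol.letter) (directedLex T₁.pol lt₁ lt₂)) ∧
        (T₁.PlanarOn Set.univ lt₁ → T₂.PlanarOn Set.univ lt₂ →
          T.PlanarOn Set.univ (directedLex T₁.pol lt₁ lt₂)) := by
  have hletters : ∀ (lt₁ : Q → Q → Prop) (lt₂ : R → R → Prop),
      IsStrictTotalOrder Q lt₁ → IsStrictTotalOrder R lt₂ →
      T₁.PlanarOn (Set.range TapeSymbol.letter) lt₁ →
      T₂.PlanarOn (Set.range TapeSymbol.letter) lt₂ →
      (T₁.product T₂).PlanarOn (Set.range TapeSymbol.letter) (directedLex T₁.pol lt₁ lt₂) := by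
    intro lt₁ lt₂ _ _ h₁ h₂
    refine TwoWayTransducer.product_planarOn hrev₁ hrev₂ h₁ h₂ ?_
    -- on a letter, no end markers are added to the output
    rintro _ ⟨a, rfl⟩ q y q' ⟨w, -, hy⟩ b hb
    simp only [reduceCtorEq, false_and, if_false, List.nil_append, List.append_nil] at hy
    subst hy
    obtain ⟨b, -, rfl⟩ := List.mem_map.1 hb
    exact ⟨b, rfl⟩
  obtain ⟨l₁, hl₁, hp₁⟩ := hpl₁
  obtain ⟨l₂, hl₂, hp₂⟩ := hpl₂
  exact ⟨T₁.product T₂, TwoWayTransducer.product_isReversible hrev₁ hrev₂,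
    ⟨_, isStrictTotalOrder_directedLex T₁.pol l₁ l₂, hletters l₁ l₂ hl₁ hl₂ hp₁ hp₂⟩,
    TwoWayTransducer.product_realizes_iff hrev₁, rfl, fun lt₁ lt₂ _ _ =>
    ⟨isStrictTotalOrder_directedLex T₁.pol lt₁ lt₂, hletters lt₁ lt₂ ‹_› ‹_›, fun h₁ h₂ =>
      TwoWayTransducer.product_planarOn hrev₁ hrev₂ h₁ h₂ fun _ _ _ _ _ _ _ _ => trivial⟩⟩
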